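/- Let $q\ge 2$ and $1\le p\le \tfrac12 q(q-1)$ be integers. Let $\mathfrak{so}(q,\mathbb R)$ be the space of real skew-symmetric $q\times q$ matrices, and let $G(p,\mathfrak{so}(q,\mathbb R))$ be the Grassmann manifold of its $p$-dimensional linear subspaces. For $W\in G(p,\mathfrak{so}(q,\mathbb R))$ let $\mathfrak N_W=\mathbb R^q\oplus W$ (orthogonal direct sum), where $\mathbb R^q$ has its standard inner product and $W$ has the inner product $\langle X,Y\rangle=\operatorname{trace}(XY^T)$. Make $\mathfrak N_W$ a 2-step nilpotent Lie algebra by letting $W$ be central and setting $[v,w]\in W$, $\langle [v,w],Z\rangle = Z(v)\cdot w$ for $v,w\in\mathbb R^q$, $Z\in W$. Let $N_W$ be the simply connected Lie group with Lie algebra $\mathfrak N_W$, equipped with the left-invariant Riemannian metric that equals this inner product at the identity. For $Z\in W$ let $\gamma_Z(t)=\exp(tZ)$, a geodesic of $N_W$. The conjugate locus of $\gamma_Z$ is the set of its conjugate values, that is, of those $t>0$ for which some Jacobi vector field along $\gamma_Z$, not identically zero, vanishes at $0$ and at $t$. For an integer $m\ge 2$ let $O_m$ be the set of $Z\in\mathfrak{so}(q,\mathbb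 R)$ whose $q$ complex eigenvalues are distinct and such that the ratio of any two distinct nonzero eigenvalues is neither $m$ nor $-m$. Let $O=\bigcap_{m\ge2}O_m$, and let $U$ be the set of $W\in G(p,\mathfrak{so}(q,\mathbb R))$ for which $W\cap O$ is nonempty. **Proposition.** Let $W_1,W_2\in G(p,\mathfrak{so}(q,\mathbb R))$ with $W_1\in U$, and let $\varphi:W_1\to W_2$ be a linear isomorphism such that for every $Z\in W_1$ the geodesics $\gamma_Z$ in $N_{W_1}$ and $\gamma_{\varphi(Z)}$ in $N_{W_2}$ have the same conjugate locus. Then $\varphi$ is a weak conjugacy: for every $Z\in W_1$ there is $g\in O(q,\mathbb R)$, which may depend on $Z$, with $\varphi(Z)=gZg^{-1}$. In particular, for every $Z\in W_1$ the matrices $Z$ and $\varphi(Z)$ have the same complex eigenvalues with the same multiplicities. -/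

import Mathlib

open scoped ContDiff Manifold

/-! ### Riemannian geometry in a global chart

`E` is a real normed space regarded as a manifold with one global chart, and `g` is a Riemannian
metric on it: `g x u v` is the inner product of the tangent vectors `u`, `v` at `x`. -/

namespace GlobalChart

variable {E : Type*} [NormedAddCommGroup E] [NormedSpace ℝ E]

/-- The right-hand side of the Koszul formula for the coordinate vector fields `u`, `v`:
`w ↦ (1/2) (u g(v, w) + v g(u, w) - w g(u, v))` at the point `x`. -/
noncomputable def koszul (g : E → E →L[ℝ] E →L[ℝ] ℝ) (x u v : E) : E →L[ℝ] ℝ :=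
  (1 / 2 : ℝ) • (fderiv ℝ g x u v + fderiv ℝ g x v u - ((fderiv ℝ g x).flip u).flip v)

/-- The Christoffel symbol `Γ_x(u, v)` of the Levi-Civita connection of `g`: the vector with
`g_x(Γ_x(u, v), w) = koszul g x u v w` for all `w`. -/
noncomputable def christoffel (g : E → E →L[ℝ] E →L[ℝ] ℝ) (x u v : E) : E :=
  (g x).inverse (koszul g x u v)

/-- The Levi-Civita covariant derivative `∇_X Y` of vector fields. -/
noncomputable def covDeriv (g : E → E →L[ℝ] E →L[ℝ] ℝ) (X Y : E → E) : E → E :=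
  fun x => fderiv ℝ Y x (X x) + christoffel g x (X x) (Y x)

/-- The Riemann curvature tensor `R(u, v)w = ∇_u ∇_v w - ∇_v ∇_u w - ∇_[u,v] w` at `x`. The tangent
vectors are extended to constant vector fields, which commute, so that the last term is zero. -/
noncomputable def curvature (g : E → E →L[ℝ] E →L[ℝ] ℝ) (x u v w : E) : E :=
  covDeriv g (fun _ => u) (covDeriv g (fun _ => v) (fun _ => w)) x -
    covDeriv g (fun _ => v) (covDeriv g (fun _ => u) (fun _ => w)) x

/-- The covariant derivative `DY/dt` of a vector field `Y` along the curve `c`. -/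
noncomputable def covDerivAlong (g : E → E →L[ℝ] E →L[ℝ] ℝ) (c Y : ℝ → E) : ℝ → E :=
  fun t => deriv Y t + christoffel g (c t) (deriv c t) (Y t)

/-- `Y` is a Jacobi vector field along `c`: `D²Y/dt² + R(Y, c')c' = 0`. -/
def IsJacobiField (g : E → E →L[ℝ] E →L[ℝ] ℝ) (c Y : ℝ → E) : Prop :=
  ContDiff ℝ ∞ Y ∧ ∀ t, covDerivAlong g c (covDerivAlong g c Y) t +
    curvature g (c t) (Y t) (deriv c t) (deriv c t) = 0

/-- The conjugate locus of the geodesic `c` starting at `c 0`, as the set of its conjugate values: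
the `t > 0` such that `c t` is conjugate to `c 0` along `c`, that is, such that some nontrivial
Jacobi field along `c` vanishes at `0` and at `t`. -/
def conjugateLocus (g : E → E →L[ℝ] E →L[ℝ] ℝ) (c : ℝ → E) : Set ℝ :=
  {t | 0 < t ∧ ∃ Y : ℝ → E, IsJacobiField g c Y ∧ Y ≠ 0 ∧ Y 0 = 0 ∧ Y t = 0}

end GlobalChart

/-! ### Subspaces of `so(q, ℝ)` with the trace inner product -/

/-- The space `so(q, ℝ)` of skew-symmetric real `q × q` matrices. -/
def soMatrices (q : ℕ) : Submodule ℝ (Matrix (Fin q) (Fin q) ℝ) where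
  carrier := {Z | Z.transpose = -Z}
  add_mem' {X Y} hX hY := by
    change (X + Y).transpose = -(X + Y)
    rw [Matrix.transpose_add, hX, hY, neg_add]
  zero_mem' := by simp
  smul_mem' r X hX := by
    change (r • X).transpose = -(r • X)
    rw [Matrix.transpose_smul, hX, smul_neg]

/-- The Grassmann manifold `G(p, so(q, ℝ))` of `p`-dimensional subspaces of `so(q, ℝ)` (as a set). -/
structure GrassmannSo (p q : ℕ) where
  plane : Submodule ℝ (Matrix (Fin q) (Fin q) ℝ)
  le_so : plane ≤ soMatrices q
  finrank_eq : Module.finrank ℝ plane = p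

section Plane

variable {p q : ℕ}

theorem GrassmannSo.transpose_eq (W : GrassmannSo p q) (Z : W.plane) :
    (Z : Matrix (Fin q) (Fin q) ℝ).transpose = -(Z : Matrix (Fin q) (Fin q) ℝ) :=
  W.le_so Z.2

/-- The vector space `W`, as a type of its own that carries the inner product below. -/
def GrassmannSo.Center (W : GrassmannSo p q) : Type := W.plane

noncomputable instance (W : GrassmannSo p q) : AddCommGroup W.Center :=
  inferInstanceAs (AddCommGroup W.plane)

noncomputable instance (W : GrassmannSo p q) : Module ℝ W.Center :=
  inferInstanceAs (Module ℝ W.plane)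

instance (W : GrassmannSo p q) : FiniteDimensional ℝ W.Center :=
  inferInstanceAs (FiniteDimensional ℝ W.plane)

/-- The identity map `W → W`, between the two types. -/
def GrassmannSo.toCenter (W : GrassmannSo p q) : W.plane ≃ₗ[ℝ] W.Center :=
  LinearEquiv.refl ℝ W.plane

/-- The element of `W` as a matrix. -/
def GrassmannSo.mat (W : GrassmannSo p q) : W.Center →ₗ[ℝ] Matrix (Fin q) (Fin q) ℝ :=
  W.plane.subtype

/-- The inner product `⟨X, Y⟩ = trace (X Yᵀ)` on `W`. -/
@[reducible]
noncomputable def GrassmannSo.traceCore (W : GrassmannSo p q) :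
    InnerProductSpace.Core ℝ W.Center where
  inner X Y := (W.mat X * (W.mat Y).transpose).trace
  conj_inner_symm X Y := by
    simp only [conj_trivial]
    rw [← Matrix.trace_transpose]
    simp
  re_inner_nonneg X := by
    change 0 ≤ (W.mat X * (W.mat X).transpose).trace
    simp only [Matrix.trace, Matrix.diag_apply, Matrix.mul_apply, Matrix.transpose_apply]
    exact Finset.sum_nonneg fun i _ => Finset.sum_nonneg fun j _ =>
      mul_self_nonneg (W.mat X i j)
  add_left X Y Z := by simp [add_mul]
  smul_left X Y r := by simp
  definite X hX := by
    have h : (W.mat X * (W.mat X).conjTranspose).trace = 0 := hX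
    rw [Matrix.trace_mul_conjTranspose_self_eq_zero_iff] at h
    exact Subtype.ext h

noncomputable instance (W : GrassmannSo p q) : NormedAddCommGroup W.Center :=
  W.traceCore.toNormedAddCommGroup

noncomputable instance (W : GrassmannSo p q) : InnerProductSpace ℝ W.Center :=
  InnerProductSpace.ofCore W.traceCore.toCore

theorem GrassmannSo.inner_center (W : GrassmannSo p q) (X Y : W.Center) :
    inner ℝ X Y = (W.mat X * (W.mat Y).transpose).trace := rfl

end Plane

/-! ### The metric Lie algebra `ℝ^q ⊕ W` and its simply connected Lie group -/

section NilpotentGroup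

variable {p q : ℕ}

/-- The inner product space `𝔑 = ℝ^q ⊕ W` (orthogonal direct sum of the Euclidean space `ℝ^q` and of
`W` with the trace inner product). It carries the Lie algebra structure `lieBracket`. The same space
is the underlying manifold of the simply connected Lie group `N` with Lie algebra `𝔑`, in
exponential coordinates, with the group structure given below. -/
def Nil (W : GrassmannSo p q) : Type :=
  WithLp 2 (EuclideanSpace ℝ (Fin q) × W.Center)

noncomputable instance (W : GrassmannSo p q) : NormedAddCommGroup (Nil W) :=
  inferInstanceAs (NormedAddCommGroup (WithLp 2 (EuclideanSpace ℝ (Fin q) × W.Center)))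

noncomputable instance (W : GrassmannSo p q) : InnerProductSpace ℝ (Nil W) :=
  inferInstanceAs (InnerProductSpace ℝ (WithLp 2 (EuclideanSpace ℝ (Fin q) × W.Center)))

instance (W : GrassmannSo p q) : FiniteDimensional ℝ (Nil W) :=
  inferInstanceAs (FiniteDimensional ℝ (WithLp 2 (EuclideanSpace ℝ (Fin q) × W.Center)))

/-- The identification of `𝔑` with the vector space `ℝ^q × W`. -/
noncomputable def Nil.equivProd (W : GrassmannSo p q) :
    Nil W ≃ₗ[ℝ] EuclideanSpace ℝ (Fin q) × W.Center :=
  WithLp.linearEquiv 2 ℝ (EuclideanSpace ℝ (Fin q) × W.Center)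

/-- The `ℝ^q`-component. -/
noncomputable def Nil.horizontal (W : GrassmannSo p q) : Nil W →ₗ[ℝ] EuclideanSpace ℝ (Fin q) :=
  LinearMap.fst ℝ _ _ ∘ₗ (Nil.equivProd W).toLinearMap

/-- The `W`-component. -/
noncomputable def Nil.central (W : GrassmannSo p q) : Nil W →ₗ[ℝ] W.Center :=
  LinearMap.snd ℝ _ _ ∘ₗ (Nil.equivProd W).toLinearMap

/-- The inclusion `W → 𝔑`. -/
noncomputable def Nil.ofCenter (W : GrassmannSo p q) : W.Center →ₗ[ℝ] Nil W :=
  (Nil.equivProd W).symm.toLinearMap ∘ₗ LinearMap.inr ℝ _ _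

theorem Nil.inner_def (W : GrassmannSo p q) (x y : Nil W) :
    inner ℝ x y = inner ℝ (Nil.horizontal W x) (Nil.horizontal W y) +
      inner ℝ (Nil.central W x) (Nil.central W y) := rfl

@[simp]
theorem Nil.horizontal_ofCenter (W : GrassmannSo p q) (Z : W.Center) :
    Nil.horizontal W (Nil.ofCenter W Z) = 0 := rfl

@[simp]
theorem Nil.central_ofCenter (W : GrassmannSo p q) (Z : W.Center) :
    Nil.central W (Nil.ofCenter W Z) = Z := rfl

variable (W : GrassmannSo p q)

/-- The linear form `Z ↦ Z(v) · w` on `W`. -/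
noncomputable def bracketForm (v w : EuclideanSpace ℝ (Fin q)) : W.Center →L[ℝ] ℝ :=
  LinearMap.toContinuousLinearMap
    { toFun := fun Z => inner ℝ (Matrix.toEuclideanLin (W.mat Z) v) w
      map_add' := by intro Z Z'; simp [inner_add_left]
      map_smul' := by intro r Z; simp [inner_smul_left] }

/-- The bracket `[v, w] ∈ W` of `v, w ∈ ℝ^q`, defined by `⟨[v, w], Z⟩ = Z(v) · w` for `Z ∈ W`. -/
noncomputable def horizontalBracket (v w : EuclideanSpace ℝ (Fin q)) : W.Center :=
  (InnerProductSpace.toDual ℝ W.Center).symm (bracketForm W v w)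

theorem inner_horizontalBracket (v w : EuclideanSpace ℝ (Fin q)) (Z : W.Center) :
    inner ℝ (horizontalBracket W v w) Z =
      inner ℝ (Matrix.toEuclideanLin (W.mat Z) v) w := by
  simp [horizontalBracket, bracketForm]

theorem inner_skew (Z : W.Center) (v w : EuclideanSpace ℝ (Fin q)) :
    inner ℝ (Matrix.toEuclideanLin (W.mat Z) v) w =
      -inner ℝ (Matrix.toEuclideanLin (W.mat Z) w) v := by
  have h : (W.mat Z).transpose = -W.mat Z := W.transpose_eq Z
  have h1 : ∀ i j, W.mat Z i j = -W.mat Z j i := by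
    intro i j
    exact congrFun (congrFun h j) i
  simp only [PiLp.inner_apply, Matrix.toEuclideanLin]
  simp [Matrix.mulVec, dotProduct, Finset.mul_sum]
  rw [Finset.sum_comm, ← Finset.sum_neg_distrib]
  refine Finset.sum_congr rfl fun i _ => ?_
  rw [← Finset.sum_neg_distrib]
  refine Finset.sum_congr rfl fun j _ => ?_
  rw [h1 j i]
  ring

/-- The bracket on `ℝ^q` as a bilinear map. -/
noncomputable def bracketBilin :
    EuclideanSpace ℝ (Fin q) →ₗ[ℝ] EuclideanSpace ℝ (Fin q) →ₗ[ℝ] W.Center :=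
  LinearMap.mk₂ ℝ (horizontalBracket W)
    (fun v v' w => ext_inner_right ℝ fun Z => by
      simp only [inner_add_left, inner_horizontalBracket, map_add])
    (fun r v w => ext_inner_right ℝ fun Z => by
      simp only [inner_smul_left, inner_horizontalBracket, map_smul])
    (fun v w w' => ext_inner_right ℝ fun Z => by
      simp only [inner_add_left, inner_horizontalBracket, inner_add_right])
    (fun r v w => ext_inner_right ℝ fun Z => by
      simp only [inner_smul_left, inner_horizontalBracket, inner_smul_right, conj_trivial])

/-- The Lie bracket of `𝔑 = ℝ^q ⊕ W`, as a bilinear map: `W` is central, and on `ℝ^q` it is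
`horizontalBracket`. -/
noncomputable def lieBracket : Nil W →L[ℝ] Nil W →L[ℝ] Nil W :=
  LinearMap.toContinuousLinearMap <| LinearMap.toContinuousLinearMap.toLinearMap ∘ₗ
    ((bracketBilin W).compl₁₂ (Nil.horizontal W) (Nil.horizontal W)).compr₂ (Nil.ofCenter W)

theorem lieBracket_apply (x y : Nil W) :
    lieBracket W x y =
      Nil.ofCenter W (horizontalBracket W (Nil.horizontal W x) (Nil.horizontal W y)) := rfl

theorem lieBracket_self (x : Nil W) : lieBracket W x x = 0 := by
  have h : horizontalBracket W (Nil.horizontal W x) (Nil.horizontal W x) = 0 :=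
    ext_inner_right ℝ fun Z => by
      have := inner_skew W Z (Nil.horizontal W x) (Nil.horizontal W x)
      rw [inner_horizontalBracket, inner_zero_left]
      linarith
  rw [lieBracket_apply, h, map_zero]

theorem lieBracket_lieBracket_left (x y z : Nil W) : lieBracket W (lieBracket W x y) z = 0 := by
  change Nil.ofCenter W (bracketBilin W 0 (Nil.horizontal W z)) = 0
  simp

theorem lieBracket_lieBracket_right (x y z : Nil W) : lieBracket W x (lieBracket W y z) = 0 := by
  change Nil.ofCenter W (bracketBilin W (Nil.horizontal W x) 0) = 0
  simp

/-- The simply connected Lie group `N` with Lie algebra `𝔑` in exponential coordinates: the product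
is given by the Baker-Campbell-Hausdorff formula `x * y = x + y + (1/2) [x, y]`. -/
noncomputable instance : Group (Nil W) where
  mul x y := x + y + (1 / 2 : ℝ) • lieBracket W x y
  one := 0
  inv x := -x
  mul_assoc x y z := by
    change x + y + (1 / 2 : ℝ) • lieBracket W x y + z +
        (1 / 2 : ℝ) • lieBracket W (x + y + (1 / 2 : ℝ) • lieBracket W x y) z =
      x + (y + z + (1 / 2 : ℝ) • lieBracket W y z) +
        (1 / 2 : ℝ) • lieBracket W x (y + z + (1 / 2 : ℝ) • lieBracket W y z)
    simp [lieBracket_lieBracket_left, lieBracket_lieBracket_right]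
    abel
  one_mul x := by
    change 0 + x + (1 / 2 : ℝ) • lieBracket W 0 x = x
    simp
  mul_one x := by
    change x + 0 + (1 / 2 : ℝ) • lieBracket W x 0 = x
    simp
  inv_mul_cancel x := by
    change -x + x + (1 / 2 : ℝ) • lieBracket W (-x) x = 0
    simp [lieBracket_self]

theorem Nil.mul_def (x y : Nil W) : x * y = x + y + (1 / 2 : ℝ) • lieBracket W x y := rfl
theorem Nil.inv_def (x : Nil W) : x⁻¹ = -x := rfl
theorem Nil.one_def : (1 : Nil W) = 0 := rfl

/-- `N` is a Lie group. -/
instance : LieGroup 𝓘(ℝ, Nil W) ∞ (Nil W) where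
  contMDiff_mul := by
    rw [← modelWithCornersSelf_prod, chartedSpaceSelf_prod]
    have h : ContDiff ℝ ∞ fun z : Nil W × Nil W => z.1 * z.2 := by
      simp only [Nil.mul_def]
      fun_prop
    exact h.contMDiff
  contMDiff_inv := by
    rw [contMDiff_iff_contDiff]
    exact contDiff_neg

/-- `N` is simply connected. -/
instance : SimplyConnectedSpace (Nil W) := inferInstance

theorem hasFDerivAt_leftMul (a x : Nil W) :
    HasFDerivAt (fun y : Nil W => a * y)
      (ContinuousLinearMap.id ℝ (Nil W) + (1 / 2 : ℝ) • lieBracket W a) x := by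
  simp only [Nil.mul_def]
  exact ((hasFDerivAt_id x).const_add a).add
    ((lieBracket W a).hasFDerivAt.fun_const_smul (1 / 2 : ℝ))

/-- The left-invariant metric of `N` that equals the inner product of `𝔑` at the identity:
`g_x(u, v) = ⟨dL u, dL v⟩`, where `dL` is the differential at `x` of left translation by `x⁻¹`. -/
noncomputable def leftInvariantMetric (x : Nil W) : Nil W →L[ℝ] Nil W →L[ℝ] ℝ :=
  (innerSL ℝ : Nil W →L[ℝ] Nil W →L[ℝ] ℝ).bilinearComp
    (fderiv ℝ (fun y : Nil W => x⁻¹ * y) x) (fderiv ℝ (fun y : Nil W => x⁻¹ * y) x)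

theorem leftInvariantMetric_apply (x u v : Nil W) :
    leftInvariantMetric W x u v =
      inner ℝ (u - (1 / 2 : ℝ) • lieBracket W x u) (v - (1 / 2 : ℝ) • lieBracket W x v) := by
  have h : ∀ w : Nil W, (ContinuousLinearMap.id ℝ (Nil W) + (1 / 2 : ℝ) • lieBracket W x⁻¹) w =
      w - (1 / 2 : ℝ) • lieBracket W x w := by
    intro w
    change w + (1 / 2 : ℝ) • lieBracket W (-x) w = _
    rw [map_neg, neg_apply, smul_neg, sub_eq_add_neg]
  rw [leftInvariantMetric, (hasFDerivAt_leftMul W x⁻¹ x).fderiv, ← h u, ← h v]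
  rfl

/-- Left translations are isometries. -/
theorem leftInvariantMetric_leftMul (a x u v : Nil W) :
    leftInvariantMetric W (a * x) (fderiv ℝ (fun y => a * y) x u) (fderiv ℝ (fun y => a * y) x v) =
      leftInvariantMetric W x u v := by
  have h : ∀ w : Nil W, w + (1 / 2 : ℝ) • lieBracket W a w -
      (1 / 2 : ℝ) • lieBracket W (a * x) (w + (1 / 2 : ℝ) • lieBracket W a w) =
      w - (1 / 2 : ℝ) • lieBracket W x w := by
    intro w
    have h1 : lieBracket W (a * x) (w + (1 / 2 : ℝ) • lieBracket W a w) =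
        lieBracket W a w + lieBracket W x w := by
      rw [map_add, map_smul, lieBracket_lieBracket_right, smul_zero, add_zero, Nil.mul_def,
        map_add, map_add, map_smul, add_apply, add_apply, smul_apply,
        lieBracket_lieBracket_left, smul_zero, add_zero]
    rw [h1, smul_add]
    abel
  rw [(hasFDerivAt_leftMul W a x).fderiv, leftInvariantMetric_apply, leftInvariantMetric_apply,
    ← h u, ← h v]
  rfl

/-- The Koszul formula determines the Christoffel symbols of the left-invariant metric. -/
theorem leftInvariantMetric_christoffel (x u v w : Nil W) :
    leftInvariantMetric W x (GlobalChart.christoffel (leftInvariantMetric W) x u v) w =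
      GlobalChart.koszul (leftInvariantMetric W) x u v w := by
  have hinj : Function.Injective (leftInvariantMetric W x) := by
    rw [injective_iff_map_eq_zero]
    intro u hu
    have h := leftInvariantMetric_apply W x u u
    rw [hu, zero_apply, eq_comm, inner_self_eq_zero, sub_eq_zero] at h
    have h2 : lieBracket W x u = 0 := by
      rw [h, map_smul, lieBracket_lieBracket_right, smul_zero]
    rw [h, h2, smul_zero]
  have hfr : Module.finrank ℝ (Nil W) = Module.finrank ℝ (Nil W →L[ℝ] ℝ) := by
    rw [← (LinearMap.toContinuousLinearMap (𝕜 := ℝ) (E := Nil W) (F' := ℝ)).finrank_eq]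
    exact (Subspace.dual_finrank_eq).symm
  have hinv : (leftInvariantMetric W x).IsInvertible :=
    ⟨(LinearEquiv.ofInjectiveOfFinrankEq _ hinj hfr).toContinuousLinearEquiv, rfl⟩
  obtain ⟨e, he⟩ := hinv
  simp only [GlobalChart.christoffel, ← he, ContinuousLinearMap.inverse_equiv]
  simp

/-- The Lie algebra of the Lie group `N` is `𝔑`. -/
theorem groupLieAlgebra_bracket (u v : GroupLieAlgebra 𝓘(ℝ, Nil W) (Nil W)) :
    (⁅u, v⁆ : GroupLieAlgebra 𝓘(ℝ, Nil W) (Nil W)) = lieBracket W u v := by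
  have h : ∀ w : Nil W, (mulInvariantVectorField (I := 𝓘(ℝ, Nil W)) (G := Nil W) w :
      Nil W → Nil W) = fun x => w + (1 / 2 : ℝ) • lieBracket W x w := by
    intro w
    funext x
    simp only [mulInvariantVectorField]
    rw [mfderiv_eq_fderiv, (hasFDerivAt_leftMul W x _).fderiv]
    rfl
  have hd : ∀ w x : Nil W, HasFDerivAt (fun x => w + (1 / 2 : ℝ) • lieBracket W x w)
      ((1 / 2 : ℝ) • (lieBracket W).flip w) x := by
    intro w x
    exact ((((lieBracket W).flip w).hasFDerivAt).fun_const_smul (1 / 2 : ℝ)).const_add w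
  have main : ∀ a b : Nil W,
      VectorField.lieBracketWithin ℝ (fun x : Nil W => a + (1 / 2 : ℝ) • lieBracket W x a)
        (fun x : Nil W => b + (1 / 2 : ℝ) • lieBracket W x b) Set.univ 0 = lieBracket W a b := by
    intro a b
    have h3 : lieBracket W b a = -lieBracket W a b := by
      have h5 := lieBracket_self W (a + b)
      simp only [map_add, add_apply, lieBracket_self, zero_add, add_zero] at h5
      exact eq_neg_of_add_eq_zero_left h5
    have h4 : (1 / 2 : ℝ) • lieBracket W a b - (1 / 2 : ℝ) • lieBracket W b a =
        lieBracket W a b := by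
      rw [h3, smul_neg, sub_neg_eq_add, ← add_smul]
      norm_num
    rw [VectorField.lieBracketWithin_univ]
    unfold VectorField.lieBracket
    rw [(hd a 0).fderiv, (hd b 0).fderiv]
    simpa using h4
  rw [GroupLieAlgebra.bracket_def, ← VectorField.mlieBracketWithin_univ,
    VectorField.mlieBracketWithin_eq_lieBracketWithin]
  exact (congrArg₂ (fun X Y : Nil W → Nil W =>
    VectorField.lieBracketWithin ℝ X Y Set.univ (0 : Nil W)) (h u) (h v)).trans (main u v)

/-- The Lie group exponential map of `N`, which is the identity map in exponential coordinates. -/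
def nilExp (X : Nil W) : Nil W := X

/-- `t ↦ exp(tX)` is the one-parameter subgroup of `N` with initial velocity `X`. -/
theorem nilExp_add_smul (X : Nil W) (s t : ℝ) :
    nilExp W ((s + t) • X) = nilExp W (s • X) * nilExp W (t • X) := by
  simp [nilExp, Nil.mul_def, lieBracket_self, add_smul]

theorem hasDerivAt_nilExp_smul (X : Nil W) :
    HasDerivAt (fun t : ℝ => nilExp W (t • X)) X 0 := by
  simpa [nilExp] using (hasDerivAt_id (0 : ℝ)).smul_const X

/-- The central geodesic `γ_Z(t) = exp(tZ)` of `N`, for `Z ∈ W ⊆ 𝔑`. -/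
noncomputable def centralGeodesic (Z : W.plane) (t : ℝ) : Nil W :=
  nilExp W (t • Nil.ofCenter W (W.toCenter Z))

/-- The conjugate locus of `γ_Z` in `N` with its left-invariant metric. -/
def centralConjugateLocus (Z : W.plane) : Set ℝ :=
  GlobalChart.conjugateLocus (leftInvariantMetric W) (centralGeodesic W Z)

end NilpotentGroup

/-! ### The set `U` and weak conjugacy -/

/-- The complex eigenvalues of a real matrix, with multiplicities. -/
noncomputable def matrixEigenvalues {q : ℕ} (A : Matrix (Fin q) (Fin q) ℝ) : Multiset ℂ :=
  (A.map Complex.ofReal).charpoly.roots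

/-- The set `O_m` of those `Z ∈ so(q, ℝ)` whose eigenvalues are distinct and such that the ratio of
any two distinct nonzero eigenvalues is neither `m` nor `-m`. -/
def setO (q m : ℕ) : Set (Matrix (Fin q) (Fin q) ℝ) :=
  {Z | Z ∈ soMatrices q ∧ (matrixEigenvalues Z).Nodup ∧
    ∀ μ ∈ matrixEigenvalues Z, ∀ ν ∈ matrixEigenvalues Z,
      μ ≠ 0 → ν ≠ 0 → μ ≠ ν → μ / ν ≠ (m : ℂ) ∧ μ / ν ≠ -(m : ℂ)}

/-- The set `U` of those `W ∈ G(p, so(q, ℝ))` that meet `O = ⋂_{m ≥ 2} O_m`. -/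
def setU (p q : ℕ) : Set (GrassmannSo p q) :=
  {W | ((W.plane : Set (Matrix (Fin q) (Fin q) ℝ)) ∩ ⋂ m ≥ 2, setO q m).Nonempty}

/-- A linear isomorphism `φ : W₁ → W₂` is a weak conjugacy if every `φ(Z)` is conjugate to `Z` by an
element of `O(q, ℝ)`, which may depend on `Z`. -/
def IsWeakConjugacy {p q : ℕ} {W₁ W₂ : GrassmannSo p q} (φ : W₁.plane ≃ₗ[ℝ] W₂.plane) : Prop :=
  ∀ Z : W₁.plane, ∃ h : Matrix.orthogonalGroup (Fin q) ℝ,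
    (φ Z : Matrix (Fin q) (Fin q) ℝ) = h.1 * (Z : Matrix (Fin q) (Fin q) ℝ) * (h⁻¹).1

/-! In exponential coordinates the Jacobi equation along `γ_Z` is linear with constant coefficients,
`Y'' = Z Y'`, where `Z` acts on `ℝ^q` and kills the centre. Diagonalising `Z` over `ℂ` splits it
into scalar equations `w'' = μ w'`. So `t > 0` is a conjugate value exactly when `exp(tμ) = 1` for
some nonzero eigenvalue `μ` of `Z` (`mem_centralConjugateLocus_iff`). The eigenvalues are imaginary,
hence the locus is the union of the sets of positive multiples of `2π/|μ|`.

If `Z` and `φ(Z)` have the same locus, every nonzero eigenvalue of either one has a nonzero integer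
multiple that is an eigenvalue of the other. Going there and back multiplies `μ` by an integer `lk`;
when `Z ∈ O` this forces `lk = ±1`, so the nonzero eigenvalues of `Z` are eigenvalues of `φ(Z)`. A
count and the vanishing trace settle the rest (`matrixEigenvalues_eq_of_mem_setO`).

For arbitrary `Z ∈ W₁`, join it by a line to some `A ∈ W₁ ∩ O`. Each condition defining `O` says
that two polynomials depending on the line parameter have no common root; it holds at `A`, so a
resultant shows that it fails only finitely often. Thus the line leaves `O` at countably many
parameters only (`countable_setOf_not_mem_iInter_setO`). The characteristic polynomials along the
line and along its image agree for infinitely many parameters, hence identically, in particular at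
`Z`.

Finally, skew-symmetric real matrices with the same characteristic polynomial are orthogonally
conjugate (`Matrix.exists_orthogonal_of_charpoly_eq`). -/

/-! ### Polynomials depending on a parameter -/

open Polynomial in
/-- A polynomial in two variables: if the fibres of `f` and `g` have no common root at one value of
the parameter, they have none at all but finitely many values. -/
theorem finite_setOf_common_root {f g : ℂ[X][X]} (hf : f.Monic) {s₀ : ℂ}
    (h₀ : ∀ a, (f.map (evalRingHom s₀)).IsRoot a → ¬(g.map (evalRingHom s₀)).IsRoot a) :
    {s | ∃ a, (f.map (evalRingHom s)).IsRoot a ∧ (g.map (evalRingHom s)).IsRoot a}.Finite := by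
  -- Since `f` is monic, its degree does not drop under specialisation, and a drop in the degree of
  -- `g` only contributes powers of the leading coefficient `1`. So the resultant at `s` is the
  -- product of the values of `g_s` at the roots of `f_s`.
  have key : ∀ s, (resultant f g f.natDegree g.natDegree).eval s =
      ((f.map (evalRingHom s)).roots.map (g.map (evalRingHom s)).eval).prod := by
    intro s
    have h1 := resultant_map_map f g f.natDegree g.natDegree (evalRingHom s)
    have h2 := resultant_eq_prod_eval (f.map (evalRingHom s)) (g.map (evalRingHom s))
      g.natDegree natDegree_map_le (IsAlgClosed.splits _)
    rw [(hf.map _).leadingCoeff, hf.natDegree_map, one_pow, one_mul, h1] at h2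
    exact h2
  have hne : resultant f g f.natDegree g.natDegree ≠ 0 := by
    intro h
    have h1 := key s₀
    rw [h, eval_zero, eq_comm, Multiset.prod_eq_zero_iff, Multiset.mem_map] at h1
    obtain ⟨a, ha, hga⟩ := h1
    exact h₀ a (isRoot_of_mem_roots ha) hga
  refine (finite_setOfPred_isRoot hne).subset ?_
  rintro s ⟨a, ha, hga⟩
  change _ = _
  rw [key, Multiset.prod_eq_zero_iff, Multiset.mem_map]
  exact ⟨a, (mem_roots (hf.map _).ne_zero).2 ha, hga⟩

open Polynomial in
theorem eq_of_infinite_map_evalRingHom_eq {f g : ℂ[X][X]}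
    (h : {s : ℂ | f.map (evalRingHom s) = g.map (evalRingHom s)}.Infinite) : f = g := by
  ext1 n
  refine eq_of_infinite_eval_eq _ _ (h.mono fun s hs => ?_)
  have := congrArg (fun p => p.coeff n) (show _ = _ from hs)
  simpa using this

/-! ### Orthogonal conjugacy of skew-symmetric matrices -/

namespace Matrix

theorem isHermitian_I_smul_of_transpose_eq_neg {n : Type*} {A : Matrix n n ℝ}
    (hA : A.transpose = -A) :
    (Complex.I • A.map Complex.ofReal).IsHermitian := by
  ext i j
  have h : A j i = -A i j := congrFun (congrFun hA i) j
  simp [h]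

variable {n : Type*} [Fintype n] [DecidableEq n]

section Skew

variable {A B : Matrix n n ℝ}

/-- The spectral theorem for the Hermitian matrix `iA`, multiplied by `-i`. -/
theorem map_ofReal_eq_of_transpose_eq_neg (hA : A.transpose = -A) :
    A.map Complex.ofReal =
      ((isHermitian_I_smul_of_transpose_eq_neg hA).eigenvectorUnitary : Matrix n n ℂ) *
        diagonal (fun j => -Complex.I *
          ((isHermitian_I_smul_of_transpose_eq_neg hA).eigenvalues j : ℂ)) *
        star ((isHermitian_I_smul_of_transpose_eq_neg hA).eigenvectorUnitary : Matrix n n ℂ) := by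
  set hH := isHermitian_I_smul_of_transpose_eq_neg hA
  have h := hH.spectral_theorem
  rw [Unitary.conjStarAlgAut_apply] at h
  have h2 : A.map Complex.ofReal = (-Complex.I) • (Complex.I • A.map Complex.ofReal) := by
    rw [smul_smul]; simp
  have h3 : diagonal (fun j => -Complex.I * (hH.eigenvalues j : ℂ)) =
      (-Complex.I) • diagonal (RCLike.ofReal ∘ hH.eigenvalues : n → ℂ) := by
    rw [← diagonal_smul]; rfl
  rw [h3, mul_smul_comm, smul_mul_assoc]
  conv_lhs => rw [h2, h]

theorem charpoly_map_ofReal_of_transpose_eq_neg (hA : A.transpose = -A) :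
    (A.map Complex.ofReal).charpoly = ∏ j, (Polynomial.X - Polynomial.C (-Complex.I *
          ((isHermitian_I_smul_of_transpose_eq_neg hA).eigenvalues j : ℂ))) := by
  conv_lhs => rw [map_ofReal_eq_of_transpose_eq_neg hA, charpoly_mul_comm, ← mul_assoc]
  simp [charpoly_diagonal]

theorem roots_charpoly_map_ofReal_of_transpose_eq_neg (hA : A.transpose = -A) :
    (A.map Complex.ofReal).charpoly.roots = Finset.univ.val.map (fun j => -Complex.I *
          ((isHermitian_I_smul_of_transpose_eq_neg hA).eigenvalues j : ℂ)) := by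
  rw [charpoly_map_ofReal_of_transpose_eq_neg hA, Finset.prod]
  have h := Polynomial.roots_multiset_prod_X_sub_C (Finset.univ.val.map (fun j => -Complex.I *
    ((isHermitian_I_smul_of_transpose_eq_neg hA).eigenvalues j : ℂ)))
  rwa [Multiset.map_map] at h

/-- Real matrices that are intertwined by an invertible complex matrix are intertwined by an
invertible real matrix. -/
theorem exists_isUnit_det_mul_eq_mul_of_complex {W : Matrix n n ℂ} (hW : IsUnit W.det)
    (h : A.map Complex.ofReal * W = W * B.map Complex.ofReal) :
    ∃ R : Matrix n n ℝ, IsUnit R.det ∧ A * R = R * B := by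
  set X : Matrix n n ℝ := W.map Complex.re
  set Y : Matrix n n ℝ := W.map Complex.im
  have hX : A * X = X * B := by
    ext i j
    have := congrArg Complex.re (congrFun (congrFun h i) j)
    simpa [mul_apply, X] using this
  have hY : A * Y = Y * B := by
    ext i j
    have := congrArg Complex.im (congrFun (congrFun h i) j)
    simpa [mul_apply, Y] using this
  -- `det(X + tY)` is a real polynomial in `t` whose value at `t = i` is `det W ≠ 0`. It is
  -- therefore not zero, and some real `t` is not a root.
  set d : Polynomial ℝ := (X.map Polynomial.C + (Polynomial.X : Polynomial ℝ) • Y.map Polynomial.C).det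
  have hd : d ≠ 0 := by
    intro hd
    have h1 : Polynomial.eval₂RingHom (algebraMap ℝ ℂ) Complex.I d = 0 := by rw [hd, map_zero]
    rw [RingHom.map_det] at h1
    have h2 : (Polynomial.eval₂RingHom (algebraMap ℝ ℂ) Complex.I).mapMatrix
        (X.map Polynomial.C + (Polynomial.X : Polynomial ℝ) • Y.map Polynomial.C) = W := by
      ext i j
      simp [X, Y]
    rw [h2] at h1
    exact hW.ne_zero h1
  obtain ⟨t, ht⟩ : ∃ t, d.eval t ≠ 0 := by
    by_contra! hc
    exact hd (Polynomial.funext (by simpa using hc))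
  refine ⟨X + t • Y, ?_, ?_⟩
  · rw [isUnit_iff_ne_zero]
    convert ht
    rw [← Polynomial.coe_evalRingHom, RingHom.map_det]
    congr 1
    ext i j
    simp [mul_comm t]
  · rw [mul_add, add_mul, mul_smul_comm, smul_mul_assoc, hX, hY]

open scoped MatrixOrder in
/-- Skew-symmetric matrices that are similar are orthogonally similar. -/
theorem exists_orthogonal_of_isUnit_det (hA : A.transpose = -A) (hB : B.transpose = -B)
    {R : Matrix n n ℝ} (hR : IsUnit R.det) (h : A * R = R * B) :
    ∃ O : orthogonalGroup n ℝ, A = O.1 * B * (O⁻¹).1 := by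
  have hT : R.transpose * A = B * R.transpose := by
    have := congrArg transpose h
    rw [transpose_mul, transpose_mul, hA, hB] at this
    simpa using this
  -- Polar decomposition: `P = RᵀR` commutes with `B`, hence so does its square root `S`, and the
  -- orthogonal factor `R S⁻¹` still intertwines `A` and `B`.
  set P := R.transpose * R
  have hP : P.PosSemidef := by
    simpa using posSemidef_conjTranspose_mul_self R
  have hPB : Commute P B := by
    change R.transpose * R * B = B * (R.transpose * R)
    rw [mul_assoc, ← h, ← mul_assoc, hT, mul_assoc]
  set S := CFC.sqrt P
  have hS : S * S = P := CFC.sqrt_mul_sqrt_self P hP.nonneg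
  have hSB : Commute S B := by
    exact (hPB.cfcₙ_nnreal NNReal.sqrt)
  have hSt : S.transpose = S := by
    have := (nonneg_iff_posSemidef.1 (CFC.sqrt_nonneg P)).isHermitian
    simpa [IsHermitian] using this
  have hSu : IsUnit S.det := by
    have h1 : S.det * S.det = R.det * R.det := by
      rw [← det_mul, hS, det_mul, det_transpose]
    rw [isUnit_iff_ne_zero] at hR ⊢
    intro h0
    rw [h0, zero_mul] at h1
    exact mul_ne_zero hR hR h1.symm
  have hSi : S⁻¹ * B = B * S⁻¹ := by
    have h1 : S⁻¹ * (S * B) * S⁻¹ = S⁻¹ * (B * S) * S⁻¹ := by rw [hSB.eq]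
    rw [nonsing_inv_mul_cancel_left _ _ hSu, ← mul_assoc, mul_nonsing_inv_cancel_right _ _ hSu] at h1
    exact h1.symm
  have hO : R * S⁻¹ ∈ orthogonalGroup n ℝ := by
    rw [mem_orthogonalGroup_iff']
    change (R * S⁻¹).transpose * (R * S⁻¹) = 1
    rw [transpose_mul, transpose_nonsing_inv, hSt]
    calc S⁻¹ * R.transpose * (R * S⁻¹) = S⁻¹ * P * S⁻¹ := by simp only [P, mul_assoc]
      _ = 1 := by rw [← hS, nonsing_inv_mul_cancel_left _ _ hSu, mul_nonsing_inv _ hSu]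
  refine ⟨⟨_, hO⟩, ?_⟩
  have h1 : R * S⁻¹ * star (R * S⁻¹) = 1 := (mem_orthogonalGroup_iff _ _).1 hO
  change A = R * S⁻¹ * B * star (R * S⁻¹)
  rw [mul_assoc R, hSi, ← mul_assoc, ← h, mul_assoc A, mul_assoc A, h1, mul_one]

/-- Both matrices are unitarily similar to the same diagonal matrix, so `U V*` intertwines them over
`ℂ`; the two preceding lemmas make the intertwiner real and then orthogonal. -/
theorem exists_orthogonal_of_charpoly_eq (hA : A.transpose = -A) (hB : B.transpose = -B)
    (h : A.charpoly = B.charpoly) :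
    ∃ O : orthogonalGroup n ℝ, A = O.1 * B * (O⁻¹).1 := by
  set hHA := isHermitian_I_smul_of_transpose_eq_neg hA
  set hHB := isHermitian_I_smul_of_transpose_eq_neg hB
  have hc : (A.map Complex.ofReal).charpoly = (B.map Complex.ofReal).charpoly := by
    have e1 := charpoly_map A Complex.ofRealHom
    have e2 := charpoly_map B Complex.ofRealHom
    rw [h] at e1
    exact e1.trans e2.symm
  -- Eigenvalues of a Hermitian matrix are listed in a fixed order, so equality of the
  -- characteristic polynomials of `iA` and `iB` gives equality of the two indexed families.
  have hroots : (hHA.eigenvalues) = hHB.eigenvalues := by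
    rw [IsHermitian.eigenvalues_eq_eigenvalues_iff, hHA.charpoly_eq, hHB.charpoly_eq]
    have h1 := congrArg Polynomial.roots hc
    rw [roots_charpoly_map_ofReal_of_transpose_eq_neg hA,
      roots_charpoly_map_ofReal_of_transpose_eq_neg hB] at h1
    have h2 := congrArg (Multiset.map fun z => Polynomial.X - Polynomial.C (Complex.I * z)) h1
    rw [Multiset.map_map, Multiset.map_map] at h2
    have h3 := congrArg Multiset.prod h2
    simp only [Function.comp_def, ← mul_assoc, mul_neg, Complex.I_mul_I, neg_neg, one_mul] at h3
    exact h3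
  set U := hHA.eigenvectorUnitary
  set V := hHB.eigenvectorUnitary
  have hU : star (U : Matrix n n ℂ) * U = 1 := Unitary.coe_star_mul_self U
  have hV : star (V : Matrix n n ℂ) * V = 1 := Unitary.coe_star_mul_self V
  obtain ⟨D, eA, eB⟩ : ∃ D : Matrix n n ℂ,
      A.map Complex.ofReal = (U : Matrix n n ℂ) * D * star (U : Matrix n n ℂ) ∧
        B.map Complex.ofReal = (V : Matrix n n ℂ) * D * star (V : Matrix n n ℂ) := by
    refine ⟨_, map_ofReal_eq_of_transpose_eq_neg hA, ?_⟩
    rw [show (isHermitian_I_smul_of_transpose_eq_neg hA).eigenvalues =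
      (isHermitian_I_smul_of_transpose_eq_neg hB).eigenvalues from hroots]
    exact map_ofReal_eq_of_transpose_eq_neg hB
  obtain ⟨R, hR, hR2⟩ := exists_isUnit_det_mul_eq_mul_of_complex (A := A) (B := B)
    (W := (U : Matrix n n ℂ) * star (V : Matrix n n ℂ))
    (by
      rw [← isUnit_iff_isUnit_det]
      exact (Unitary.toUnits (U * star V)).isUnit)
    (by
      rw [eA, eB]
      simp only [mul_assoc]
      rw [← mul_assoc (star (U : Matrix n n ℂ)), hU, ← mul_assoc (star (V : Matrix n n ℂ)) V, hV,
        one_mul, one_mul])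
  exact exists_orthogonal_of_isUnit_det hA hB hR hR2

end Skew

end Matrix

/-! ### The Jacobi equation along a central geodesic -/

section Geometry

variable {p q : ℕ} (W : GrassmannSo p q)

/-- The inclusion `ℝ^q → 𝔑`. -/
noncomputable def Nil.ofHorizontal : EuclideanSpace ℝ (Fin q) →ₗ[ℝ] Nil W :=
  (Nil.equivProd W).symm.toLinearMap ∘ₗ LinearMap.inl ℝ _ _

@[simp]
theorem Nil.horizontal_ofHorizontal (v : EuclideanSpace ℝ (Fin q)) :
    Nil.horizontal W (Nil.ofHorizontal W v) = v := rfl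

@[simp]
theorem Nil.central_ofHorizontal (v : EuclideanSpace ℝ (Fin q)) :
    Nil.central W (Nil.ofHorizontal W v) = 0 := rfl

theorem Nil.ext_iff' {x y : Nil W} :
    x = y ↔ Nil.horizontal W x = Nil.horizontal W y ∧ Nil.central W x = Nil.central W y := by
  constructor
  · rintro rfl
    exact ⟨rfl, rfl⟩
  · rintro ⟨h1, h2⟩
    exact (Nil.equivProd W).injective (Prod.ext h1 h2)

theorem Nil.inner_ofCenter_left (Z : W.Center) (x : Nil W) :
    inner ℝ (Nil.ofCenter W Z) x = inner ℝ Z (Nil.central W x) := by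
  simp [Nil.inner_def]

theorem Nil.inner_ofHorizontal_left (v : EuclideanSpace ℝ (Fin q)) (x : Nil W) :
    inner ℝ (Nil.ofHorizontal W v) x = inner ℝ v (Nil.horizontal W x) := by
  simp [Nil.inner_def]

/-- The operator `v + X ↦ Z(v)` of `𝔑 = ℝ^q ⊕ W`, for `Z ∈ W`. -/
noncomputable def centralOp (Z : W.Center) : Nil W →L[ℝ] Nil W :=
  LinearMap.toContinuousLinearMap
    (Nil.ofHorizontal W ∘ₗ Matrix.toEuclideanLin (W.mat Z) ∘ₗ Nil.horizontal W)

theorem centralOp_apply (Z : W.Center) (x : Nil W) :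
    centralOp W Z x =
      Nil.ofHorizontal W (Matrix.toEuclideanLin (W.mat Z) (Nil.horizontal W x)) := rfl

@[simp]
theorem centralOp_ofCenter (Z X : W.Center) : centralOp W Z (Nil.ofCenter W X) = 0 := by
  simp [centralOp_apply]

@[simp]
theorem centralOp_zero (x : Nil W) : centralOp W 0 x = 0 := by
  simp [centralOp_apply]

@[simp]
theorem lieBracket_ofCenter_right (x : Nil W) (Z : W.Center) :
    lieBracket W x (Nil.ofCenter W Z) = 0 := by
  change Nil.ofCenter W (bracketBilin W (Nil.horizontal W x) 0) = 0
  simp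

@[simp]
theorem lieBracket_ofCenter_left (x : Nil W) (Z : W.Center) :
    lieBracket W (Nil.ofCenter W Z) x = 0 := by
  change Nil.ofCenter W (bracketBilin W 0 (Nil.horizontal W x)) = 0
  simp

theorem lieBracket_swap (x y : Nil W) : lieBracket W y x = -lieBracket W x y := by
  have h := lieBracket_self W (x + y)
  simp only [map_add, add_apply, lieBracket_self, zero_add, add_zero] at h
  exact eq_neg_of_add_eq_zero_left h

theorem inner_ofCenter_lieBracket (Z : W.Center) (x y : Nil W) :
    inner ℝ (Nil.ofCenter W Z) (lieBracket W x y) = inner ℝ (centralOp W Z x) y := by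
  rw [centralOp_apply, Nil.inner_ofHorizontal_left, lieBracket_apply, Nil.inner_ofCenter_left,
    Nil.central_ofCenter, real_inner_comm, inner_horizontalBracket]

theorem contDiff_leftInvariantMetric : ContDiff ℝ ∞ (leftInvariantMetric W) := by
  rw [contDiff_clm_apply_iff]
  intro u
  rw [contDiff_clm_apply_iff]
  intro v
  simp only [leftInvariantMetric_apply]
  exact ContDiff.inner ℝ (by fun_prop) (by fun_prop)

/-- Along the line `x + tu` the metric is an explicit inner product of two functions affine in `t`;
its derivative at `t = 0` is given by the product rule. -/
theorem fderiv_leftInvariantMetric (x u v w : Nil W) :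
    fderiv ℝ (leftInvariantMetric W) x u v w =
      -(1 / 2 : ℝ) * inner ℝ (lieBracket W u v) (w - (1 / 2 : ℝ) • lieBracket W x w) -
        (1 / 2 : ℝ) * inner ℝ (v - (1 / 2 : ℝ) • lieBracket W x v) (lieBracket W u w) := by
  have h1 := ((contDiff_leftInvariantMetric W).differentiable (by simp) x).hasFDerivAt
  have h2 : HasDerivAt (fun t : ℝ => leftInvariantMetric W (x + t • u) v w)
      (fderiv ℝ (leftInvariantMetric W) x u v w) 0 := by
    have hl : HasDerivAt (fun t : ℝ => x + t • u) u 0 := by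
      simpa using ((hasDerivAt_id (0 : ℝ)).smul_const u).const_add x
    have h3 : HasDerivAt (fun t : ℝ => leftInvariantMetric W (x + t • u))
        (fderiv ℝ (leftInvariantMetric W) x u) 0 :=
      HasFDerivAt.comp_hasDerivAt (l := leftInvariantMetric W) (f := fun t : ℝ => x + t • u) 0
        (by simpa using h1) hl
    exact (h3.clm_apply (hasDerivAt_const 0 v)).clm_apply (hasDerivAt_const 0 w) |>.congr_deriv
      (by simp)
  have h4 : HasDerivAt (fun t : ℝ => leftInvariantMetric W (x + t • u) v w)
      (-(1 / 2 : ℝ) * inner ℝ (lieBracket W u v) (w - (1 / 2 : ℝ) • lieBracket W x w) -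
        (1 / 2 : ℝ) * inner ℝ (v - (1 / 2 : ℝ) • lieBracket W x v) (lieBracket W u w)) 0 := by
    have hb : ∀ a : Nil W, HasDerivAt
        (fun t : ℝ => a - (1 / 2 : ℝ) • lieBracket W (x + t • u) a)
        (-((1 / 2 : ℝ) • lieBracket W u a)) 0 := by
      intro a
      have : HasDerivAt (fun t : ℝ => t • lieBracket W u a) (lieBracket W u a) 0 := by
        simpa using (hasDerivAt_id (0 : ℝ)).smul_const (lieBracket W u a)
      have h5 := (((this.const_add (lieBracket W x a)).const_smul (1 / 2 : ℝ)).const_sub a)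
      simpa using h5
    have h6 := (hb v).inner ℝ (hb w)
    simp only [leftInvariantMetric_apply]
    refine h6.congr_deriv ?_
    simp only [zero_smul, add_zero, inner_neg_left, inner_neg_right, inner_smul_left,
      inner_smul_right, conj_trivial]
    ring
  exact h2.unique h4

/-- Nondegeneracy: if `u = (1/2)[x, u]`, then `u` is central, so `[x, u] = 0` and `u = 0`. -/
theorem leftInvariantMetric_ext {x a b : Nil W}
    (h : ∀ w, leftInvariantMetric W x a w = leftInvariantMetric W x b w) : a = b := by
  have h1 := leftInvariantMetric_apply W x (a - b) (a - b)
  have h0 : leftInvariantMetric W x (a - b) (a - b) = 0 := by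
    rw [map_sub (leftInvariantMetric W x), sub_apply, h, sub_self]
  rw [h0, eq_comm, inner_self_eq_zero, sub_eq_zero] at h1
  have h2 : lieBracket W x (a - b) = 0 := by
    rw [h1, map_smul, lieBracket_lieBracket_right, smul_zero]
  rw [h2, smul_zero] at h1
  exact sub_eq_zero.1 h1

/-- This is `∇_u Z = -(1/2) Z(u)`, with `Z(u)` left-translated from the identity to `x`; the
translation is `a ↦ a + (1/2)[x, a]`. In the Koszul formula the derivative of the metric in the
direction `Z` vanishes, and the other two terms both equal `-(1/2)⟨Z, [u, w]⟩`. -/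
theorem christoffel_ofCenter_right (x u : Nil W) (Z : W.Center) :
    GlobalChart.christoffel (leftInvariantMetric W) x u (Nil.ofCenter W Z) =
      -(1 / 2 : ℝ) • (centralOp W Z u + (1 / 2 : ℝ) • lieBracket W x (centralOp W Z u)) := by
  refine leftInvariantMetric_ext W (x := x) fun w => ?_
  have hk : GlobalChart.koszul (leftInvariantMetric W) x u (Nil.ofCenter W Z) w =
      -(1 / 2 : ℝ) * inner ℝ (centralOp W Z u) w := by
    change (1 / 2 : ℝ) * (fderiv ℝ (leftInvariantMetric W) x u (Nil.ofCenter W Z) w +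
      fderiv ℝ (leftInvariantMetric W) x (Nil.ofCenter W Z) u w -
      fderiv ℝ (leftInvariantMetric W) x w u (Nil.ofCenter W Z)) = _
    simp only [fderiv_leftInvariantMetric, lieBracket_ofCenter_right, lieBracket_ofCenter_left,
      smul_zero, sub_zero, inner_zero_left, inner_zero_right, mul_zero]
    rw [lieBracket_swap W u w, inner_neg_left, real_inner_comm (Nil.ofCenter W Z),
      inner_ofCenter_lieBracket]
    ring
  have hL : ∀ a : Nil W, a + (1 / 2 : ℝ) • lieBracket W x a -
      (1 / 2 : ℝ) • lieBracket W x (a + (1 / 2 : ℝ) • lieBracket W x a) = a := by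
    intro a
    simp [lieBracket_lieBracket_right]
  have h0 : inner ℝ (centralOp W Z u) (lieBracket W x w) = 0 := by
    rw [← inner_ofCenter_lieBracket, lieBracket_lieBracket_right, inner_zero_right]
  rw [leftInvariantMetric_christoffel, hk, map_smul, smul_apply, leftInvariantMetric_apply, hL,
    inner_sub_right, inner_smul_right, h0, mul_zero, sub_zero, smul_eq_mul]

theorem christoffel_ofCenter_left (x u : Nil W) (Z : W.Center) :
    GlobalChart.christoffel (leftInvariantMetric W) x (Nil.ofCenter W Z) u =
      -(1 / 2 : ℝ) • (centralOp W Z u + (1 / 2 : ℝ) • lieBracket W x (centralOp W Z u)) := by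
  rw [← christoffel_ofCenter_right]
  refine leftInvariantMetric_ext W (x := x) fun w => ?_
  rw [leftInvariantMetric_christoffel, leftInvariantMetric_christoffel]
  change (1 / 2 : ℝ) * (fderiv ℝ (leftInvariantMetric W) x (Nil.ofCenter W Z) u w +
      fderiv ℝ (leftInvariantMetric W) x u (Nil.ofCenter W Z) w -
      fderiv ℝ (leftInvariantMetric W) x w (Nil.ofCenter W Z) u) =
    (1 / 2 : ℝ) * (fderiv ℝ (leftInvariantMetric W) x u (Nil.ofCenter W Z) w +
      fderiv ℝ (leftInvariantMetric W) x (Nil.ofCenter W Z) u w -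
      fderiv ℝ (leftInvariantMetric W) x w u (Nil.ofCenter W Z))
  simp only [fderiv_leftInvariantMetric, lieBracket_ofCenter_right, lieBracket_ofCenter_left,
    smul_zero, sub_zero, inner_zero_left, inner_zero_right, mul_zero]
  rw [real_inner_comm (lieBracket W w u)]
  ring

/-- As `∇_Z Z = 0`, only `-∇_Z ∇_u Z` remains. Its derivative part contains a bracket with `Z` and
vanishes, so it is minus the square of `-(1/2) Z`, applied to `u`. -/
theorem curvature_ofCenter (Z X : W.Center) (u : Nil W) :
    GlobalChart.curvature (leftInvariantMetric W) (Nil.ofCenter W X) u (Nil.ofCenter W Z)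
      (Nil.ofCenter W Z) = -(1 / 4 : ℝ) • centralOp W Z (centralOp W Z u) := by
  have h1 : GlobalChart.covDeriv (leftInvariantMetric W) (fun _ => Nil.ofCenter W Z)
      (fun _ => Nil.ofCenter W Z) = fun _ => 0 := by
    funext x
    simp [GlobalChart.covDeriv, christoffel_ofCenter_right]
  have h2 : GlobalChart.covDeriv (leftInvariantMetric W) (fun _ => u)
      (fun _ => Nil.ofCenter W Z) = fun x =>
      -(1 / 2 : ℝ) • (centralOp W Z u + (1 / 2 : ℝ) • lieBracket W x (centralOp W Z u)) := by
    funext x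
    simp [GlobalChart.covDeriv, christoffel_ofCenter_right]
  have h3 : HasFDerivAt (fun x : Nil W =>
      -(1 / 2 : ℝ) • (centralOp W Z u + (1 / 2 : ℝ) • lieBracket W x (centralOp W Z u)))
      (-(1 / 2 : ℝ) • (1 / 2 : ℝ) • (lieBracket W).flip (centralOp W Z u)) (Nil.ofCenter W X) :=
    ((((lieBracket W).flip (centralOp W Z u)).hasFDerivAt.fun_const_smul (1 / 2 : ℝ)).const_add
      (centralOp W Z u)).fun_const_smul (-(1 / 2 : ℝ))
  have h4 : GlobalChart.christoffel (leftInvariantMetric W) (Nil.ofCenter W X) u 0 = 0 := by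
    simpa using christoffel_ofCenter_right W (Nil.ofCenter W X) u 0
  rw [GlobalChart.curvature, h1, h2]
  simp only [GlobalChart.covDeriv, h3.fderiv, christoffel_ofCenter_left, h4]
  simp [smul_smul]
  norm_num

theorem deriv_centralGeodesic (Z : W.plane) (t : ℝ) :
    deriv (centralGeodesic W Z) t = Nil.ofCenter W (W.toCenter Z) := by
  have h : HasDerivAt (fun t : ℝ => t • Nil.ofCenter W (W.toCenter Z))
      (Nil.ofCenter W (W.toCenter Z)) t := by
    simpa using (hasDerivAt_id t).smul_const (Nil.ofCenter W (W.toCenter Z))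
  exact h.deriv

/-- With `DY = Y' - (1/2) Z Y` one gets `D²Y = Y'' - Z Y' + (1/4) Z² Y`, and the curvature term
cancels `(1/4) Z² Y`. -/
theorem isJacobiField_centralGeodesic_iff (Z : W.plane) (Y : ℝ → Nil W) :
    GlobalChart.IsJacobiField (leftInvariantMetric W) (centralGeodesic W Z) Y ↔
      ContDiff ℝ ∞ Y ∧ ∀ t, deriv (deriv Y) t = centralOp W (W.toCenter Z) (deriv Y t) := by
  refine and_congr_right fun hY => forall_congr' fun t => ?_
  have hc : ∀ t, centralGeodesic W Z t = Nil.ofCenter W (t • W.toCenter Z) := fun t =>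
    (map_smul (Nil.ofCenter W) t (W.toCenter Z)).symm
  have hD : ∀ V : ℝ → Nil W, GlobalChart.covDerivAlong (leftInvariantMetric W)
      (centralGeodesic W Z) V =
        fun t => deriv V t + -(1 / 2 : ℝ) • centralOp W (W.toCenter Z) (V t) := by
    intro V
    funext s
    simp [GlobalChart.covDerivAlong, deriv_centralGeodesic, christoffel_ofCenter_left, hc]
  have hY1 : HasDerivAt Y (deriv Y t) t := (hY.differentiable (by simp) t).hasDerivAt
  have hY2 : HasDerivAt (deriv Y) (deriv (deriv Y) t) t :=
    ((hY.iterate_deriv 1).differentiable (by simp) t).hasDerivAt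
  have hDD : HasDerivAt (fun t => deriv Y t + -(1 / 2 : ℝ) • centralOp W (W.toCenter Z) (Y t))
      (deriv (deriv Y) t + -(1 / 2 : ℝ) • centralOp W (W.toCenter Z) (deriv Y t)) t :=
    hY2.add (HasDerivAt.fun_const_smul (-(1 / 2 : ℝ))
      ((centralOp W (W.toCenter Z)).hasFDerivAt.comp_hasDerivAt t hY1))
  rw [hD, hD, deriv_centralGeodesic, hc, curvature_ofCenter]
  beta_reduce
  rw [hDD.deriv, ← sub_eq_zero (a := deriv (deriv Y) t)]
  refine Eq.congr_left ?_
  simp only [map_add, map_smul]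
  module

end Geometry

/-- The scalar equation `w'' = μ w'` with the boundary values `w(0) = w(t) = 0`. -/
theorem eq_zero_of_deriv_deriv_eq_mul_deriv {w w' : ℝ → ℂ} {μ : ℂ} {t : ℝ} (ht : 0 < t)
    (hw : ∀ s, HasDerivAt w (w' s) s) (hw' : ∀ s, HasDerivAt w' (μ * w' s) s)
    (h0 : w 0 = 0) (h1 : w t = 0) (hμ : μ = 0 ∨ Complex.exp (t * μ) ≠ 1) (s : ℝ) : w s = 0 := by
  -- A first integral of the equation: `w' - μ w` is constant.
  have hlin : ∀ s, w' s - μ * w s = w' 0 := by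
    have hd : ∀ s, HasDerivAt (fun s => w' s - μ * w s) 0 s := fun s =>
      ((hw' s).sub ((hw s).const_mul μ)).congr_deriv (sub_self _)
    intro s
    have := is_const_of_deriv_eq_zero (fun s => (hd s).differentiableAt) (fun s => (hd s).deriv) s 0
    simpa [h0] using this
  have hexp : ∀ s : ℝ, w' s = w' 0 * Complex.exp (s * μ) := by
    have he : ∀ s : ℝ, HasDerivAt (fun s : ℝ => Complex.exp (-(s * μ)))
        (Complex.exp (-(s * μ)) * -μ) s := fun s => by
      have := (((hasDerivAt_id s).ofReal_comp.mul_const μ).neg).cexp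
      simpa using this
    have hd : ∀ s, HasDerivAt (fun s : ℝ => w' s * Complex.exp (-(s * μ))) 0 s := fun s =>
      ((hw' s).mul (he s)).congr_deriv (by ring)
    intro s
    have := is_const_of_deriv_eq_zero (fun s => (hd s).differentiableAt) (fun s => (hd s).deriv) s 0
    simp only [Complex.ofReal_zero, zero_mul, neg_zero, Complex.exp_zero, mul_one] at this
    rw [← this, mul_assoc, ← Complex.exp_add, neg_add_cancel, Complex.exp_zero, mul_one]
  -- If `μ = 0`, then `w` is affine and vanishes at two points. Otherwise the first integral at `t`
  -- reads `w'(0) exp(tμ) = w'(0)`.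
  have hc : w' 0 = 0 := by
    rcases hμ with rfl | hμ
    · have hd : ∀ s, HasDerivAt (fun s : ℝ => w s - s * w' 0) 0 s := fun s => by
        have h2 := (hw s).sub ((hasDerivAt_id s).ofReal_comp.mul_const (w' 0))
        refine h2.congr_deriv ?_
        have := hlin s
        simp only [zero_mul, sub_zero] at this
        simp [this]
      have := is_const_of_deriv_eq_zero (fun s => (hd s).differentiableAt)
        (fun s => (hd s).deriv) t 0
      simpa [h0, h1, ht.ne'] using this
    · have h2 := hlin t
      rw [h1, mul_zero, sub_zero, hexp t] at h2
      by_contra hne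
      exact hμ (mul_left_cancel₀ hne (h2.trans (mul_one _).symm))
  have hd : ∀ s, HasDerivAt w 0 s := fun s => (hw s).congr_deriv (by rw [hexp, hc, zero_mul])
  rw [is_const_of_deriv_eq_zero (fun s => (hd s).differentiableAt) (fun s => (hd s).deriv) s 0, h0]

/-! ### Eigenvalues of a skew-symmetric matrix -/

section Spectrum

variable {q : ℕ} {A : Matrix (Fin q) (Fin q) ℝ}

theorem re_eq_zero_of_mem_matrixEigenvalues (hA : A.transpose = -A) {μ : ℂ}
    (h : μ ∈ matrixEigenvalues A) : μ.re = 0 := by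
  rw [matrixEigenvalues, Matrix.roots_charpoly_map_ofReal_of_transpose_eq_neg hA,
    Multiset.mem_map] at h
  obtain ⟨j, -, rfl⟩ := h
  simp

theorem card_matrixEigenvalues (A : Matrix (Fin q) (Fin q) ℝ) : (matrixEigenvalues A).card = q := by
  rw [matrixEigenvalues, IsAlgClosed.card_roots_eq_natDegree, Matrix.charpoly_natDegree_eq_dim,
    Fintype.card_fin]

theorem sum_matrixEigenvalues (hA : A.transpose = -A) : (matrixEigenvalues A).sum = 0 := by
  rw [matrixEigenvalues, ← Matrix.trace_eq_sum_roots_charpoly]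
  have h : A.trace = 0 := by
    have := congrArg Matrix.trace hA
    rw [Matrix.trace_transpose, Matrix.trace_neg] at this
    linarith
  have := congrArg Complex.ofReal h
  simpa [Matrix.trace] using this

theorem mem_matrixEigenvalues_iff_isRoot {μ : ℂ} :
    μ ∈ matrixEigenvalues A ↔ (A.map Complex.ofReal).charpoly.IsRoot μ :=
  Polynomial.mem_roots (Matrix.charpoly_monic _).ne_zero

theorem mem_matrixEigenvalues_iff {μ : ℂ} :
    μ ∈ matrixEigenvalues A ↔ ∃ v : Fin q → ℂ, v ≠ 0 ∧ (A.map Complex.ofReal).mulVec v = μ • v := by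
  rw [mem_matrixEigenvalues_iff_isRoot, Polynomial.IsRoot, Matrix.eval_charpoly,
    ← Matrix.exists_mulVec_eq_zero_iff]
  refine exists_congr fun v => and_congr_right fun _ => ?_
  rw [Matrix.sub_mulVec, sub_eq_zero, eq_comm, Matrix.scalar_apply, ← Matrix.smul_one_eq_diagonal,
    Matrix.smul_mulVec, Matrix.one_mulVec]

theorem star_mem_matrixEigenvalues {μ : ℂ} (h : μ ∈ matrixEigenvalues A) :
    (starRingEnd ℂ) μ ∈ matrixEigenvalues A := by
  rw [mem_matrixEigenvalues_iff] at h ⊢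
  obtain ⟨v, hv, h⟩ := h
  refine ⟨star v, by simpa using hv, ?_⟩
  ext i
  have := congrArg (starRingEnd ℂ) (congrFun h i)
  simpa [Matrix.mulVec, dotProduct] using this

theorem neg_mem_matrixEigenvalues (hA : A.transpose = -A) {μ : ℂ} (h : μ ∈ matrixEigenvalues A) :
    -μ ∈ matrixEigenvalues A := by
  have h1 := star_mem_matrixEigenvalues h
  have h2 := re_eq_zero_of_mem_matrixEigenvalues hA h
  rwa [show (starRingEnd ℂ) μ = -μ from Complex.ext (by simp [h2]) (by simp)] at h1

end Spectrum

/-! ### Conjugate values in terms of eigenvalues -/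

section Locus

variable {p q : ℕ} (W : GrassmannSo p q)

theorem Nil.horizontal_centralOp (Z : W.Center) (x : Nil W) (i : Fin q) :
    Nil.horizontal W (centralOp W Z x) i = ∑ j, W.mat Z i j * Nil.horizontal W x j := by
  simp [centralOp_apply, Matrix.toLpLin_apply, Matrix.mulVec, dotProduct]

/-- The linear form `x ↦ ∑ i, a i * x i` on the horizontal component, with complex coefficients. -/
noncomputable def Nil.horizontalForm (a : Fin q → ℂ) : Nil W →L[ℝ] ℂ :=
  LinearMap.toContinuousLinearMap
    { toFun := fun x => ∑ i, a i * (Nil.horizontal W x i : ℂ)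
      map_add' := by intro x y; simp [mul_add, Finset.sum_add_distrib]
      map_smul' := by intro r x; simp [Finset.mul_sum, mul_left_comm] }

theorem Nil.horizontalForm_apply (a : Fin q → ℂ) (x : Nil W) :
    Nil.horizontalForm W a x = ∑ i, a i * (Nil.horizontal W x i : ℂ) := rfl

theorem Nil.horizontalForm_centralOp (Z : W.Center) {a : Fin q → ℂ} {μ : ℂ}
    (ha : Matrix.vecMul a ((W.mat Z).map Complex.ofReal) = μ • a) (x : Nil W) :
    Nil.horizontalForm W a (centralOp W Z x) = μ * Nil.horizontalForm W a x := by
  simp only [Nil.horizontalForm_apply, Nil.horizontal_centralOp, Complex.ofReal_sum,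
    Complex.ofReal_mul, Finset.mul_sum]
  rw [Finset.sum_comm]
  refine Finset.sum_congr rfl fun j _ => ?_
  have h := congrFun ha j
  simp only [Matrix.vecMul, dotProduct, Matrix.map_apply, Pi.smul_apply, smul_eq_mul] at h
  rw [← mul_assoc, ← h, Finset.sum_mul]
  exact Finset.sum_congr rfl fun i _ => (mul_assoc _ _ _).symm

/-- The linear form `x ↦ ⟨X, x⟩` on the central component. -/
noncomputable def Nil.centralForm (X : W.Center) : Nil W →L[ℝ] ℂ :=
  LinearMap.toContinuousLinearMap
    (Complex.ofRealCLM.toLinearMap ∘ₗ (innerSL ℝ X).toLinearMap ∘ₗ Nil.central W)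

theorem Nil.centralForm_apply (X : W.Center) (x : Nil W) :
    Nil.centralForm W X x = (inner ℝ X (Nil.central W x) : ℝ) := rfl

/-- The real part of a complex vector as a horizontal vector. -/
noncomputable def Nil.ofRe : (Fin q → ℂ) →L[ℝ] Nil W :=
  LinearMap.toContinuousLinearMap
    { toFun := fun a => Nil.ofHorizontal W (WithLp.toLp 2 fun i => (a i).re)
      map_add' := by intro a b; rw [← map_add]; congr 1
      map_smul' := by intro r a; rw [← map_smul]; congr 1; ext i; simp }

theorem Nil.horizontal_ofRe (a : Fin q → ℂ) (i : Fin q) :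
    Nil.horizontal W (Nil.ofRe W a) i = (a i).re := rfl

theorem centralOp_ofRe (Z : W.Center) (a : Fin q → ℂ) :
    centralOp W Z (Nil.ofRe W a) =
      Nil.ofRe W (((W.mat Z).map Complex.ofReal).mulVec a) := by
  rw [Nil.ext_iff']
  refine ⟨?_, rfl⟩
  ext i
  rw [Nil.horizontal_centralOp, Nil.horizontal_ofRe]
  simp [Matrix.mulVec, dotProduct, Nil.horizontal_ofRe]

/-- A linear form that is a left eigenvector of the operator `Z` turns a Jacobi field into a
solution of the scalar equation. If no nonzero eigenvalue satisfied `exp(tμ) = 1`, all such forms,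
which separate points, would vanish on the field. -/
theorem exists_of_mem_centralConjugateLocus {Z : W.plane} {t : ℝ}
    (h : t ∈ centralConjugateLocus W Z) :
    ∃ μ ∈ matrixEigenvalues (Z : Matrix (Fin q) (Fin q) ℝ), μ ≠ 0 ∧ Complex.exp (t * μ) = 1 := by
  obtain ⟨ht, Y, hY, hne, h0, h1⟩ := h
  rw [isJacobiField_centralGeodesic_iff] at hY
  obtain ⟨hY, hode⟩ := hY
  have hY1 : ∀ s, HasDerivAt Y (deriv Y s) s := fun s =>
    (hY.differentiable (by simp) s).hasDerivAt
  have hY2 : ∀ s, HasDerivAt (deriv Y) (centralOp W (W.toCenter Z) (deriv Y s)) s := fun s => by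
    rw [← hode]
    exact ((hY.iterate_deriv 1).differentiable (by simp) s).hasDerivAt
  have key : ∀ (l : Nil W →L[ℝ] ℂ) (μ : ℂ),
      (∀ x, l (centralOp W (W.toCenter Z) x) = μ * l x) →
      (μ = 0 ∨ Complex.exp (t * μ) ≠ 1) → ∀ s, l (Y s) = 0 := by
    intro l μ hl hμ
    refine eq_zero_of_deriv_deriv_eq_mul_deriv (w := fun s => l (Y s))
      (w' := fun s => l (deriv Y s)) (μ := μ) ht
      (fun s => l.hasFDerivAt.comp_hasDerivAt s (hY1 s)) (fun s => ?_) (by simp [h0])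
      (by simp [h1]) hμ
    rw [← hl]
    exact l.hasFDerivAt.comp_hasDerivAt s (hY2 s)
  by_contra! hcon
  apply hne
  funext s
  change Y s = 0
  rw [Nil.ext_iff']
  have hA : (Z : Matrix (Fin q) (Fin q) ℝ).transpose = -(Z : Matrix (Fin q) (Fin q) ℝ) :=
    W.transpose_eq Z
  constructor
  · set U := (Matrix.isHermitian_I_smul_of_transpose_eq_neg hA).eigenvectorUnitary
    set d := fun j => -Complex.I *
      ((Matrix.isHermitian_I_smul_of_transpose_eq_neg hA).eigenvalues j : ℂ)
    have hU : star (U : Matrix (Fin q) (Fin q) ℂ) * U = 1 := Unitary.coe_star_mul_self U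
    have hU' : (U : Matrix (Fin q) (Fin q) ℂ) * star (U : Matrix (Fin q) (Fin q) ℂ) = 1 :=
      Unitary.coe_mul_star_self U
    have hd : (Z : Matrix (Fin q) (Fin q) ℝ).map Complex.ofReal =
        (U : Matrix (Fin q) (Fin q) ℂ) * Matrix.diagonal d * star (U : Matrix (Fin q) (Fin q) ℂ) :=
      Matrix.map_ofReal_eq_of_transpose_eq_neg hA
    -- The rows of `U*` are left eigenvectors of `Z`.
    have hrow : star (U : Matrix (Fin q) (Fin q) ℂ) *
        (Z : Matrix (Fin q) (Fin q) ℝ).map Complex.ofReal =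
        Matrix.diagonal d * star (U : Matrix (Fin q) (Fin q) ℂ) := by
      rw [hd, ← mul_assoc, ← mul_assoc, hU, one_mul]
    have hz : ∀ j, ∑ i, star (U : Matrix (Fin q) (Fin q) ℂ) j i * (Nil.horizontal W (Y s) i : ℂ) =
        0 := by
      intro j
      refine key (Nil.horizontalForm W (star (U : Matrix (Fin q) (Fin q) ℂ) j)) (d j) ?_ ?_ s
      · refine Nil.horizontalForm_centralOp W (W.toCenter Z) ?_
        ext i
        have := congrFun (congrFun hrow j) i
        rw [Matrix.diagonal_mul] at this
        exact this
      · by_cases hj : d j = 0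
        · exact Or.inl hj
        · refine Or.inr (hcon _ ?_ hj)
          rw [matrixEigenvalues, Matrix.roots_charpoly_map_ofReal_of_transpose_eq_neg hA]
          exact Multiset.mem_map_of_mem d (Finset.mem_univ j)
    have hz2 : (fun i => (Nil.horizontal W (Y s) i : ℂ)) = 0 := by
      have h2 : Matrix.mulVec (star (U : Matrix (Fin q) (Fin q) ℂ))
          (fun i => (Nil.horizontal W (Y s) i : ℂ)) = 0 := funext hz
      have h3 := congrArg (Matrix.mulVec (U : Matrix (Fin q) (Fin q) ℂ)) h2
      rwa [Matrix.mulVec_mulVec, hU', Matrix.one_mulVec, Matrix.mulVec_zero] at h3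
    ext i
    exact Complex.ofReal_eq_zero.1 (congrFun hz2 i)
  -- Forms on the centre are annihilated by `Z`, which is the case `μ = 0`.
  · rw [map_zero]
    refine ext_inner_left ℝ fun X => ?_
    have := key (Nil.centralForm W X) 0 (fun x => by
      simp [Nil.centralForm_apply, centralOp_apply]) (Or.inl rfl) s
    rw [Nil.centralForm_apply, Complex.ofReal_eq_zero] at this
    rw [this, inner_zero_right]

theorem mem_centralConjugateLocus_of_exp_eq_one {Z : W.plane} {t : ℝ} (ht : 0 < t) {μ : ℂ}
    (hμ : μ ∈ matrixEigenvalues (Z : Matrix (Fin q) (Fin q) ℝ)) (hμ0 : μ ≠ 0)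
    (he : Complex.exp (t * μ) = 1) : t ∈ centralConjugateLocus W Z := by
  have hre := re_eq_zero_of_mem_matrixEigenvalues (W.transpose_eq Z) hμ
  obtain ⟨v, hv, hZv⟩ := mem_matrixEigenvalues_iff.1 hμ
  have hexp : ∀ s : ℝ, HasDerivAt (fun s : ℝ => Complex.exp (s * μ)) (μ * Complex.exp (s * μ)) s :=
    fun s => by
      have := ((hasDerivAt_id s).ofReal_comp.mul_const μ).cexp
      simpa [mul_comm] using this
  -- The real part of the complex solution `(exp(sμ) - 1) v`, where `v` is an eigenvector for `μ`.
  set Y : ℝ → Nil W := fun s => Nil.ofRe W ((Complex.exp (s * μ) - 1) • v)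
  have hY1 : ∀ s : ℝ, HasDerivAt Y (Nil.ofRe W ((μ * Complex.exp (s * μ)) • v)) s := fun s =>
    (Nil.ofRe W).hasFDerivAt.comp_hasDerivAt s (((hexp s).sub_const 1).smul_const v)
  have hY1' : deriv Y = fun s : ℝ => Nil.ofRe W ((μ * Complex.exp (s * μ)) • v) :=
    funext fun s => (hY1 s).deriv
  have hY2 : ∀ s : ℝ, HasDerivAt (deriv Y) (Nil.ofRe W ((μ * (μ * Complex.exp (s * μ))) • v)) s := by
    intro s
    rw [hY1']
    exact (Nil.ofRe W).hasFDerivAt.comp_hasDerivAt s (((hexp s).const_mul μ).smul_const v)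
  refine ⟨ht, Y, (isJacobiField_centralGeodesic_iff W Z Y).2 ⟨?_, fun s => ?_⟩, ?_, ?_, ?_⟩
  · have h1 : ContDiff ℝ ∞ fun s : ℝ => Complex.exp (s * μ) :=
      (Complex.ofRealCLM.contDiff.mul contDiff_const).cexp
    exact (Nil.ofRe W).contDiff.comp ((h1.sub contDiff_const).smul contDiff_const)
  · rw [(hY2 s).deriv, hY1']
    beta_reduce
    rw [centralOp_ofRe]
    change _ = Nil.ofRe W (((Z : Matrix (Fin q) (Fin q) ℝ).map Complex.ofReal).mulVec _)
    rw [Matrix.mulVec_smul, hZv, smul_smul, mul_comm]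
  -- Taking real parts could have killed the solution. But `Y'(0) = Re(μv)` and `Y''(0) = Re(μ²v)`,
  -- and since `μ` is imaginary and nonzero they detect `Im v` and `Re v` respectively.
  · intro hY
    have h1 : deriv Y = 0 := by rw [hY]; exact deriv_const' _
    have h2 : deriv (deriv Y) = 0 := by rw [h1]; exact deriv_const' _
    have e1 : Nil.ofRe W (μ • v) = 0 := by
      simpa [hY1'] using congrFun h1 0
    have e2 : Nil.ofRe W ((μ * μ) • v) = 0 := by
      simpa [(hY2 0).deriv] using congrFun h2 0
    apply hv
    funext i
    have e1i : (μ * v i).re = 0 := by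
      simpa [e1] using (Nil.horizontal_ofRe W (μ • v) i).symm
    have e2i : (μ * μ * v i).re = 0 := by
      simpa [e2] using (Nil.horizontal_ofRe W ((μ * μ) • v) i).symm
    have him : μ.im ≠ 0 := fun h => hμ0 (Complex.ext hre h)
    simp only [Complex.mul_re, Complex.mul_im, hre, zero_mul, zero_sub, mul_zero, add_zero,
      sub_zero, neg_eq_zero, mul_eq_zero, neg_mul, him, or_self, false_or] at e1i e2i
    exact Complex.ext (by simpa using e2i) (by simpa using e1i)
  · simp [Y]
  · simp [Y, he]

theorem mem_centralConjugateLocus_iff {Z : W.plane} {t : ℝ} :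
    t ∈ centralConjugateLocus W Z ↔ 0 < t ∧
      ∃ μ ∈ matrixEigenvalues (Z : Matrix (Fin q) (Fin q) ℝ), μ ≠ 0 ∧ Complex.exp (t * μ) = 1 :=
  ⟨fun h => ⟨h.1, exists_of_mem_centralConjugateLocus W h⟩,
    fun ⟨ht, _, hμ, h0, he⟩ => mem_centralConjugateLocus_of_exp_eq_one W ht hμ h0 he⟩

end Locus

/-! ### Equal conjugate loci for a generic element -/

section Generic

variable {p q : ℕ} {W₁ W₂ : GrassmannSo p q} {Z₁ : W₁.plane} {Z₂ : W₂.plane}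

/-- The conjugate value `t = 2π/|μ|` of `Z₁` is one of `Z₂`, so `exp(tν) = 1` for a nonzero
eigenvalue `ν` of `Z₂`; this makes `ν` an integer multiple of `2πi/t = ±μ`. -/
theorem exists_int_mul_mem_matrixEigenvalues
    (h : centralConjugateLocus W₁ Z₁ ⊆ centralConjugateLocus W₂ Z₂) {μ : ℂ}
    (hμ : μ ∈ matrixEigenvalues (Z₁ : Matrix (Fin q) (Fin q) ℝ)) (hμ0 : μ ≠ 0) :
    ∃ k : ℤ, k ≠ 0 ∧ k * μ ∈ matrixEigenvalues (Z₂ : Matrix (Fin q) (Fin q) ℝ) := by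
  have hre := re_eq_zero_of_mem_matrixEigenvalues (W₁.transpose_eq Z₁) hμ
  have him : μ.im ≠ 0 := fun h => hμ0 (Complex.ext hre h)
  have hμI : μ = μ.im * Complex.I := Complex.ext (by simp [hre]) (by simp)
  obtain ⟨ε, hε, hεμ⟩ : ∃ ε : ℤ, ε * ε = 1 ∧ |μ.im| = ε * μ.im := by
    rcases abs_choice μ.im with h | h
    · exact ⟨1, by simp, by simpa using h⟩
    · exact ⟨-1, by simp, by simpa using h⟩
  have ht : 0 < 2 * Real.pi / |μ.im| := by positivity
  have hε' : (ε : ℂ) * ε = 1 := by exact_mod_cast hε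
  have hε0 : (ε : ℂ) ≠ 0 := left_ne_zero_of_mul_eq_one hε'
  have him' : (μ.im : ℂ) ≠ 0 := by exact_mod_cast him
  have htμ : ((2 * Real.pi / |μ.im| : ℝ) : ℂ) * μ = ε * (2 * Real.pi * Complex.I) := by
    rw [hεμ]
    nth_rewrite 2 [hμI]
    push_cast
    field_simp
    linear_combination -hε'
  have hmem := (mem_centralConjugateLocus_iff W₂).1 (h
    (mem_centralConjugateLocus_of_exp_eq_one W₁ ht hμ hμ0 (by
      rw [htμ]; exact Complex.exp_int_mul_two_pi_mul_I ε)))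
  obtain ⟨-, ν, hν, hν0, hexp⟩ := hmem
  obtain ⟨n, hn⟩ := Complex.exp_eq_one_iff.1 hexp
  have ht0 : ((2 * Real.pi / |μ.im| : ℝ) : ℂ) ≠ 0 := by exact_mod_cast ht.ne'
  have hνμ : ν = (n * ε : ℤ) * μ := by
    apply mul_left_cancel₀ ht0
    rw [mul_left_comm, htμ, hn]
    push_cast
    linear_combination (-(n : ℂ) * (2 * Real.pi * Complex.I)) * hε'
  refine ⟨n * ε, ?_, hνμ ▸ hν⟩
  intro h0
  rw [h0] at hνμ
  simp [hν0] at hνμ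

theorem matrixEigenvalues_eq_of_mem_setO
    (hZ : (Z₁ : Matrix (Fin q) (Fin q) ℝ) ∈ ⋂ m ≥ 2, setO q m)
    (h : centralConjugateLocus W₁ Z₁ = centralConjugateLocus W₂ Z₂) :
    matrixEigenvalues (Z₁ : Matrix (Fin q) (Fin q) ℝ) =
      matrixEigenvalues (Z₂ : Matrix (Fin q) (Fin q) ℝ) := by
  rw [Set.mem_iInter₂] at hZ
  have hnd := (hZ 2 le_rfl).2.1
  have hmem : ∀ μ ∈ matrixEigenvalues (Z₁ : Matrix (Fin q) (Fin q) ℝ), μ ≠ 0 →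
      μ ∈ matrixEigenvalues (Z₂ : Matrix (Fin q) (Fin q) ℝ) := by
    intro μ hμ hμ0
    obtain ⟨k, hk0, hk⟩ := exists_int_mul_mem_matrixEigenvalues h.le hμ hμ0
    obtain ⟨l, hl0, hl⟩ := exists_int_mul_mem_matrixEigenvalues h.ge hk
      (mul_ne_zero (by exact_mod_cast hk0) hμ0)
    -- Both `μ` and `lkμ` are eigenvalues of `Z₁`, and `Z₁ ∈ O_m` for `m = |lk|` excludes `|lk| ≥
    -- 2`.
    have hlk : (l * k).natAbs = 1 := by
      by_contra hne
      have h2 : 2 ≤ (l * k).natAbs := by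
        have : (l * k).natAbs ≠ 0 := Int.natAbs_ne_zero.2 (mul_ne_zero hl0 hk0)
        omega
      rw [← mul_assoc] at hl
      have h3 := (hZ _ h2).2.2 _ hl μ hμ
        (mul_ne_zero (mul_ne_zero (by exact_mod_cast hl0) (by exact_mod_cast hk0)) hμ0) hμ0
        (by
          intro h4
          have h5 : ((l * k : ℤ) : ℂ) = 1 := by
            push_cast
            exact mul_right_cancel₀ hμ0 (h4.trans (one_mul μ).symm)
          have h6 : l * k = 1 := by exact_mod_cast h5
          rw [h6] at hne
          exact hne rfl)
      rw [mul_div_cancel_right₀ _ hμ0] at h3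
      have h4 := Int.natAbs_eq (l * k)
      generalize (l * k).natAbs = m at h3 h4
      rcases h4 with h4 | h4
      · exact h3.1 (by exact_mod_cast h4)
      · exact h3.2 (by exact_mod_cast h4)
    rw [Int.natAbs_mul] at hlk
    rcases Int.natAbs_eq_iff.1 (Nat.eq_one_of_mul_eq_one_left hlk) with rfl | rfl
    · simpa using hk
    · simpa using neg_mem_matrixEigenvalues (W₂.transpose_eq Z₂) hk
  set S₁ := matrixEigenvalues (Z₁ : Matrix (Fin q) (Fin q) ℝ)
  set S₂ := matrixEigenvalues (Z₂ : Matrix (Fin q) (Fin q) ℝ)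
  -- Distinctness of the eigenvalues of `Z₁` turns membership into an inclusion of multisets. The
  -- complement `R` has as many elements as `0` has occurrences in `S₁`, at most one, and its sum is
  -- `0` because both traces vanish.
  have hle : S₁.filter (· ≠ 0) ≤ S₂ :=
    (Multiset.le_iff_subset (hnd.filter _)).2 fun μ hμ =>
      hmem μ (Multiset.mem_filter.1 hμ).1 (Multiset.mem_filter.1 hμ).2
  obtain ⟨R, hR⟩ := Multiset.le_iff_exists_add.1 hle
  have hS₁ : S₁ = S₁.filter (· ≠ 0) + S₁.filter (· = 0) := by
    rw [add_comm]
    exact (Multiset.filter_add_not (· = 0) S₁).symm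
  have hc : (S₁.filter (· = 0)).card = R.card := by
    have h1 := congrArg Multiset.card hR
    have h2 := congrArg Multiset.card hS₁
    rw [Multiset.card_add] at h1 h2
    have h3 : S₁.card = S₂.card :=
      (card_matrixEigenvalues _).trans (card_matrixEigenvalues _).symm
    omega
  have hs : R.sum = (S₁.filter (· = 0)).sum := by
    have h1 := congrArg Multiset.sum hR
    have h2 := congrArg Multiset.sum hS₁
    rw [Multiset.sum_add] at h1 h2
    have h3 : S₁.sum = S₂.sum := (sum_matrixEigenvalues (W₁.transpose_eq Z₁)).trans
      (sum_matrixEigenvalues (W₂.transpose_eq Z₂)).symm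
    rw [h1, h2] at h3
    exact (add_left_cancel h3).symm
  have hc1 : (S₁.filter (· = 0)).card ≤ 1 := by
    rw [← Multiset.countP_eq_card_filter]
    have := Multiset.nodup_iff_count_le_one.1 hnd 0
    simpa [Multiset.count, eq_comm] using this
  have hRe : R = S₁.filter (· = 0) := by
    rcases Nat.le_one_iff_eq_zero_or_eq_one.1 hc1 with h0 | h0
    · rw [Multiset.card_eq_zero.1 h0, Multiset.card_eq_zero.1 (hc.symm.trans h0)]
    · obtain ⟨a, ha⟩ := Multiset.card_eq_one.1 h0
      obtain ⟨b, hb⟩ := Multiset.card_eq_one.1 (hc.symm.trans h0)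
      rw [ha, hb, Multiset.sum_singleton, Multiset.sum_singleton] at hs
      rw [ha, hb, hs]
  rw [hR, hRe]
  exact hS₁

end Generic

/-! ### Lines of skew-symmetric matrices -/

section Pencil

open Polynomial

variable {q : ℕ}

/-- The line `s ↦ A + s (B - A)` of matrices, as a matrix of complex polynomials in `s`. -/
noncomputable def matrixPencil (A B : Matrix (Fin q) (Fin q) ℝ) : Matrix (Fin q) (Fin q) ℂ[X] :=
  (A.map Complex.ofReal).map C + (X : ℂ[X]) • ((B - A).map Complex.ofReal).map C

theorem charpoly_matrixPencil_map (A B : Matrix (Fin q) (Fin q) ℝ) (s : ℝ) :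
    (matrixPencil A B).charpoly.map (evalRingHom (s : ℂ)) =
      ((A + s • (B - A)).map Complex.ofReal).charpoly := by
  rw [← Matrix.charpoly_map]
  congr 1
  ext i j
  simp [matrixPencil]

theorem matrixPencil_transpose {A B : Matrix (Fin q) (Fin q) ℝ} (hA : A.transpose = -A)
    (hB : B.transpose = -B) : (matrixPencil A B).transpose = -matrixPencil A B := by
  ext i j
  have h1 : A j i = -A i j := congrFun (congrFun hA i) j
  have h2 : B j i = -B i j := congrFun (congrFun hB i) j
  simp only [matrixPencil, Matrix.transpose_apply, Matrix.add_apply, Matrix.smul_apply,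
    Matrix.map_apply, Matrix.sub_apply, Matrix.neg_apply, h1, h2, smul_eq_mul]
  rw [show -B i j - -A i j = -(B i j - A i j) by ring, Complex.ofReal_neg, Complex.ofReal_neg,
    C_neg, C_neg, mul_neg, neg_add]

theorem det_eq_zero_of_transpose_eq_neg_of_odd {R : Type*} [CommRing R] [IsDomain R] [CharZero R]
    {M : Matrix (Fin q) (Fin q) R} (hM : M.transpose = -M) (hq : Odd q) : M.det = 0 := by
  have h := congrArg Matrix.det hM
  rw [Matrix.det_transpose, Matrix.det_neg, Fintype.card_fin, hq.neg_one_pow, neg_one_mul] at h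
  exact self_eq_neg.1 h

theorem charpoly_comp_neg_X_of_even {A : Matrix (Fin q) (Fin q) ℂ} (hA : A.transpose = -A)
    (hq : Even q) : A.charpoly.comp (-X) = A.charpoly := by
  refine Polynomial.funext fun x => ?_
  rw [eval_comp, Matrix.eval_charpoly, Matrix.eval_charpoly, eval_neg, eval_X,
    ← Matrix.det_transpose, Matrix.transpose_sub, hA]
  rw [show (Matrix.scalar (Fin q) (-x)).transpose - -A = -(Matrix.scalar (Fin q) x - A) by
    ext i j; by_cases h : i = j <;> simp [h, Matrix.diagonal, sub_eq_neg_add, eq_comm, add_comm]]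
  rw [Matrix.det_neg, Fintype.card_fin, hq.neg_one_pow, one_mul]

theorem nodup_roots_iff {P : ℂ[X]} (hP : P ≠ 0) :
    P.roots.Nodup ↔ ∀ a, P.IsRoot a → ¬(derivative P).IsRoot a := by
  rw [Multiset.nodup_iff_count_le_one]
  refine forall_congr' fun a => ?_
  rw [count_roots, ← not_lt, one_lt_rootMultiplicity_iff_isRoot hP, not_and]

/-- In even size the characteristic polynomial is an even function, so its derivative vanishes at
`0` and a root `0` would be multiple. -/
theorem not_isRoot_zero_of_even {A : Matrix (Fin q) (Fin q) ℂ} (hA : A.transpose = -A)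
    (hq : Even q) (hnd : A.charpoly.roots.Nodup) : ¬A.charpoly.IsRoot 0 := by
  intro h0
  refine (nodup_roots_iff A.charpoly_monic.ne_zero).1 hnd 0 h0 ?_
  have h1 := congrArg derivative (charpoly_comp_neg_X_of_even hA hq)
  have h2 := congrArg (eval 0) h1
  simp only [derivative_comp, derivative_neg, derivative_X, eval_neg, eval_comp, eval_X, neg_zero, neg_mul, one_mul] at h2
  exact self_eq_neg.1 h2.symm

/-- The characteristic polynomial of a line of skew-symmetric matrices, one of which has distinct
eigenvalues, without the root `0` that all the matrices may have. -/
theorem exists_reduced_charpoly {A B : Matrix (Fin q) (Fin q) ℝ} (hA : A.transpose = -A)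
    (hB : B.transpose = -B) (hnd : (matrixEigenvalues A).Nodup) :
    ∃ Q : ℂ[X][X], Q.Monic ∧
      ((matrixPencil A B).charpoly = Q ∨ (matrixPencil A B).charpoly = X * Q) ∧
      ¬(Q.map (evalRingHom 0)).IsRoot 0 := by
  have h0 : (matrixPencil A B).charpoly.map (evalRingHom 0) = (A.map Complex.ofReal).charpoly := by
    simpa using charpoly_matrixPencil_map A B 0
  -- If `0` is a root for every parameter, divide by `X` once; a remaining root `0` at `A` would be
  -- a double eigenvalue. If not, the size is even, since a skew-symmetric determinant of odd size
  -- vanishes.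
  by_cases hc : (matrixPencil A B).charpoly.coeff 0 = 0
  · have hP : (matrixPencil A B).charpoly = X * (matrixPencil A B).charpoly.divX := by
      have := X_mul_divX_add (matrixPencil A B).charpoly
      rw [hc, C_0, add_zero] at this
      exact this.symm
    refine ⟨_, monic_X.of_mul_monic_left (hP ▸ Matrix.charpoly_monic _), Or.inr hP, fun hr => ?_⟩
    rw [hP, Polynomial.map_mul, map_X] at h0
    rw [matrixEigenvalues] at hnd
    refine (nodup_roots_iff (Matrix.charpoly_monic _).ne_zero).1 hnd 0 ?_ ?_
    · rw [← h0]; simp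
    · rw [← h0, IsRoot, derivative_mul]
      simpa using hr
  · refine ⟨_, Matrix.charpoly_monic _, Or.inl rfl, ?_⟩
    rw [h0]
    refine not_isRoot_zero_of_even ?_ ?_ hnd
    · ext i j
      have : A j i = -A i j := congrFun (congrFun hA i) j
      simp [this]
    · by_contra hodd
      apply hc
      have := Matrix.det_eq_sign_charpoly_coeff (matrixPencil A B)
      rw [det_eq_zero_of_transpose_eq_neg_of_odd (matrixPencil_transpose hA hB)
        (Nat.not_even_iff_odd.1 hodd)] at this
      simpa using this.symm

/-- All but countably many members of a line of skew-symmetric matrices that meets `⋂ m, O_m`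
belong to `⋂ m, O_m`. -/
theorem countable_setOf_not_mem_iInter_setO {A B : Matrix (Fin q) (Fin q) ℝ}
    (hA : A ∈ ⋂ m ≥ 2, setO q m) (hB : B.transpose = -B) :
    {s : ℝ | A + s • (B - A) ∉ ⋂ m ≥ 2, setO q m}.Countable := by
  rw [Set.mem_iInter₂] at hA
  have hAt : A.transpose = -A := (hA 2 le_rfl).1
  have hnd : (matrixEigenvalues A).Nodup := (hA 2 le_rfl).2.1
  obtain ⟨Q, hQm, hPQ, hQ0⟩ := exists_reduced_charpoly hAt hB hnd
  set P := (matrixPencil A B).charpoly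
  have hPs : ∀ s : ℝ, P.map (evalRingHom (s : ℂ)) =
      ((A + s • (B - A)).map Complex.ofReal).charpoly := charpoly_matrixPencil_map A B
  have hP0 : P.map (evalRingHom 0) = (A.map Complex.ofReal).charpoly := by simpa using hPs 0
  have hQP : ∀ (s a : ℂ), (Q.map (evalRingHom s)).IsRoot a → (P.map (evalRingHom s)).IsRoot a := by
    intro s a h
    rcases hPQ with h1 | h1 <;> rw [h1]
    · exact h
    · rw [Polynomial.map_mul]
      exact root_mul_left_of_isRoot _ h
  have hPQ' : ∀ (s a : ℂ), a ≠ 0 → (P.map (evalRingHom s)).IsRoot a →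
      (Q.map (evalRingHom s)).IsRoot a := by
    intro s a ha h
    rcases hPQ with h1 | h1 <;> rw [h1] at h
    · exact h
    · rw [Polynomial.map_mul, map_X, root_mul] at h
      exact h.resolve_left (by simpa using ha)
  have hcomp : ∀ (k : ℤ) (s a : ℂ), ((Q.comp (C (C (k : ℂ)) * X)).map (evalRingHom s)).IsRoot a ↔
      (Q.map (evalRingHom s)).IsRoot (k * a) := by
    intro k s a
    rw [IsRoot, IsRoot, Polynomial.map_comp]
    simp
  have hfin : {s | ∃ a, (P.map (evalRingHom s)).IsRoot a ∧
      ((derivative P).map (evalRingHom s)).IsRoot a}.Finite := by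
    refine finite_setOf_common_root (s₀ := 0) (Matrix.charpoly_monic _) fun a => ?_
    rw [← derivative_map, hP0]
    exact (nodup_roots_iff (Matrix.charpoly_monic _).ne_zero).1 hnd a
  -- A common root of `Q(x)` and `Q(kx)` is a pair of eigenvalues of ratio `k`. The root `0` would
  -- be common to both for every `k`, which is why `Q` replaces `P`. Negative `k` covers the ratios
  -- `-m`.
  have hfin2 : ∀ k : ℤ, 2 ≤ k.natAbs → {s | ∃ a, (Q.map (evalRingHom s)).IsRoot a ∧
      ((Q.comp (C (C (k : ℂ)) * X)).map (evalRingHom s)).IsRoot a}.Finite := by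
    intro k hk
    refine finite_setOf_common_root (s₀ := 0) hQm fun a ha hka => ?_
    rw [hcomp] at hka
    have ha0 : a ≠ 0 := by rintro rfl; exact hQ0 ha
    have hk0 : (k : ℂ) ≠ 0 := by
      rw [Int.cast_ne_zero]
      rintro rfl
      simp at hk
    have ha' := hQP 0 a ha
    have hka' := hQP 0 _ hka
    rw [hP0, ← mem_matrixEigenvalues_iff_isRoot] at ha' hka'
    have h3 := (hA _ hk).2.2 _ hka' _ ha' (mul_ne_zero hk0 ha0) ha0 (by
      intro h4
      have h5 : (k : ℂ) = 1 := mul_right_cancel₀ ha0 (h4.trans (one_mul a).symm)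
      rw [Int.cast_eq_one] at h5
      rw [h5] at hk
      simp at hk)
    rw [mul_div_cancel_right₀ _ ha0] at h3
    have h4 := Int.natAbs_eq k
    generalize k.natAbs = m at h3 h4
    rcases h4 with h4 | h4
    · exact h3.1 (by exact_mod_cast h4)
    · exact h3.2 (by exact_mod_cast h4)
  have hcount : ({s | ∃ a, (P.map (evalRingHom s)).IsRoot a ∧
      ((derivative P).map (evalRingHom s)).IsRoot a} ∪
      ⋃ k : {k : ℤ // 2 ≤ k.natAbs}, {s | ∃ a, (Q.map (evalRingHom s)).IsRoot a ∧
        ((Q.comp (C (C ((k : ℤ) : ℂ)) * X)).map (evalRingHom s)).IsRoot a}).Countable :=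
    hfin.countable.union (Set.countable_iUnion fun k => (hfin2 k k.2).countable)
  refine (hcount.preimage Complex.ofReal_injective).mono fun s hs => ?_
  by_contra hbad
  rw [Set.mem_preimage, Set.mem_union, not_or, Set.mem_iUnion, not_exists] at hbad
  obtain ⟨hb1, hb2⟩ := hbad
  have hratio : ∀ k : ℤ, 2 ≤ k.natAbs → ∀ μ ∈ matrixEigenvalues (A + s • (B - A)),
      ∀ ν ∈ matrixEigenvalues (A + s • (B - A)), μ ≠ 0 → ν ≠ 0 → μ / ν ≠ k := by
    intro k hk μ hμ ν hν hμ0 hν0 h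
    rw [div_eq_iff hν0] at h
    rw [mem_matrixEigenvalues_iff_isRoot, ← hPs] at hμ hν
    refine hb2 ⟨k, hk⟩ ⟨ν, hPQ' _ _ hν0 hν, ?_⟩
    rw [hcomp, ← h]
    exact hPQ' _ _ hμ0 hμ
  refine hs (Set.mem_iInter₂.2 fun m hm => ⟨?_, ?_, ?_⟩)
  · change (A + s • (B - A)).transpose = -(A + s • (B - A))
    rw [Matrix.transpose_add, Matrix.transpose_smul, Matrix.transpose_sub, hAt, hB]
    module
  · rw [matrixEigenvalues, ← hPs, nodup_roots_iff ((Matrix.charpoly_monic _).map _).ne_zero]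
    intro a ha hd
    rw [derivative_map] at hd
    exact hb1 ⟨a, ha, hd⟩
  · intro μ hμ ν hν hμ0 hν0 _
    refine ⟨?_, ?_⟩
    · simpa using hratio m (by simpa using hm) μ hμ ν hν hμ0 hν0
    · simpa using hratio (-m) (by simpa using hm) μ hμ ν hν hμ0 hν0

theorem charpoly_map_ofReal_eq_iff {A B : Matrix (Fin q) (Fin q) ℝ} :
    (A.map Complex.ofReal).charpoly = (B.map Complex.ofReal).charpoly ↔
      matrixEigenvalues A = matrixEigenvalues B := by
  refine ⟨fun h => congrArg roots h, fun h => ?_⟩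
  rw [(IsAlgClosed.splits _).eq_prod_roots_of_monic (Matrix.charpoly_monic (A.map Complex.ofReal)),
    (IsAlgClosed.splits _).eq_prod_roots_of_monic (Matrix.charpoly_monic (B.map Complex.ofReal))]
  rw [show (A.map Complex.ofReal).charpoly.roots = _ from h]
  rfl

theorem charpoly_eq_of_matrixEigenvalues_eq {A B : Matrix (Fin q) (Fin q) ℝ}
    (h : matrixEigenvalues A = matrixEigenvalues B) : A.charpoly = B.charpoly := by
  have h1 := charpoly_map_ofReal_eq_iff.2 h
  apply Polynomial.map_injective Complex.ofRealHom Complex.ofReal_injective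
  rw [← Matrix.charpoly_map, ← Matrix.charpoly_map]
  exact h1

/-- Two lines of matrices with the same eigenvalues for all but countably many parameters have the
same eigenvalues throughout. -/
theorem matrixEigenvalues_eq_of_countable {A B A' B' : Matrix (Fin q) (Fin q) ℝ}
    (h : {s : ℝ | matrixEigenvalues (A + s • (B - A)) ≠
      matrixEigenvalues (A' + s • (B' - A'))}.Countable) :
    matrixEigenvalues B = matrixEigenvalues B' := by
  have hinf : {s : ℝ | matrixEigenvalues (A + s • (B - A)) =
      matrixEigenvalues (A' + s • (B' - A'))}.Infinite := by
    -- Were the parameters of agreement finite in number, `ℝ` would be countable.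
    intro hfin
    apply Cardinal.not_countable_real
    refine (hfin.countable.union h).mono fun s _ => ?_
    exact em _
  have heq : (matrixPencil A B).charpoly = (matrixPencil A' B').charpoly := by
    refine eq_of_infinite_map_evalRingHom_eq
      ((hinf.image Complex.ofReal_injective.injOn).mono ?_)
    rintro _ ⟨s, hs, rfl⟩
    change _ = _
    rw [charpoly_matrixPencil_map, charpoly_matrixPencil_map]
    exact charpoly_map_ofReal_eq_iff.2 hs
  -- The parameter `s = 1` is the endpoint `B` of the line.
  have h1 := charpoly_matrixPencil_map A B 1
  have h2 := charpoly_matrixPencil_map A' B' 1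
  rw [heq, h2] at h1
  simpa using (charpoly_map_ofReal_eq_iff.1 h1).symm

end Pencil

/-! ### The proposition -/

theorem proposition9p1 (p q : ℕ) (hq : 2 ≤ q) (hp : 1 ≤ p) (hpq : p ≤ q * (q - 1) / 2)
    (W₁ W₂ : GrassmannSo p q) (hW₁ : W₁ ∈ setU p q) (φ : W₁.plane ≃ₗ[ℝ] W₂.plane)
    (hφ : ∀ Z : W₁.plane, centralConjugateLocus W₁ Z = centralConjugateLocus W₂ (φ Z)) :
    IsWeakConjugacy φ ∧
      ∀ Z : W₁.plane, matrixEigenvalues (Z : Matrix (Fin q) (Fin q) ℝ) =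
        matrixEigenvalues (φ Z : Matrix (Fin q) (Fin q) ℝ) := by
  obtain ⟨A, hA, hAO⟩ := hW₁
  have key : ∀ Z : W₁.plane, matrixEigenvalues (Z : Matrix (Fin q) (Fin q) ℝ) =
      matrixEigenvalues (φ Z : Matrix (Fin q) (Fin q) ℝ) := by
    intro Z
    -- The line through `A` and `Z` stays in `W₁`, and by linearity `φ` maps it to the line through
    -- `φ(A)` and `φ(Z)`. The loci agree at each parameter, so the spectra agree wherever the line
    -- lies in `O`.
    refine matrixEigenvalues_eq_of_countable (A := A) (A' := φ ⟨A, hA⟩)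
      ((countable_setOf_not_mem_iInter_setO hAO (W₁.transpose_eq Z)).mono ?_)
    intro s hs hmem
    refine hs ?_
    have h := matrixEigenvalues_eq_of_mem_setO (Z₁ := ⟨A, hA⟩ + s • (Z - ⟨A, hA⟩)) hmem (hφ _)
    rw [map_add, map_smul, map_sub] at h
    exact h
  refine ⟨fun Z => ?_, key⟩
  exact Matrix.exists_orthogonal_of_charpoly_eq (W₂.transpose_eq (φ Z)) (W₁.transpose_eq Z)
    (charpoly_eq_of_matrixEigenvalues_eq (key Z)).symm
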